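/- Let $X_1,\dots,X_m$ be Hermitian, traceless $d\times d$ matrices with $\operatorname{Tr}X_jX_k=\delta_{jk}$, and let $H_\theta=\sum_{j=1}^m\theta^jX_j$ for $\theta\in\mathbb R^m$. Assume that the model is spherical, i.e. $\sum_jX_j^2$ is a scalar multiple of the identity. An estimation procedure consists of $r$ driven channels, an ancilla Hilbert space $\mathcal H_A$ of arbitrary dimension, a unit vector $|q_{\rm ini}\rangle\in(\mathbb C^d)^{\otimes r}\otimes\mathcal H_A$, unitaries $V_1,\dots,V_n$ of this space, times $t_0,\dots,t_n\ge0$, a number $N$ of copies, a quantum measurement (POVM) of $|q_\theta\rangle^{\otimes N}$, where $$|q_\theta\rangle=U_r(t_n)V_n\cdots U_r(t_1)V_1U_r(t_0)|q_{\rm ini}\rangle,\qquad U_r(t)=(e^{-itH_\theta})^{\otimes r}\otimes I_A ,$$ and an estimator $\theta^*\in\mathbb R^m$, a measurable function of the outcome. Its evolution time is $\tau=t_0+\dots+t_n$ and its total time is $T=Nr\tau$. For $\delta,E>0$ it is successful if $\mathbb P_\theta[\|\theta^*-\theta\|>\delta]\le 0.05$ for all $\|\theta\|\le E$. For a bounded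 estimator let $b(\theta)=\mathbb E_\theta[\theta^*]-\theta$ be the bias, $D(\theta)=(\partial_jb_k(\theta))_{jk}$ its derivative and $V(\theta)$ the covariance matrix of $\theta^*$ under $\mathbb P_\theta$. Let $\delta>0$ and $E\ge5\delta$. Then the following holds for every procedure. 1. If it is successful, then $$T\ \ge\ \frac{(md)^{1/2}}{4\sqrt6\,\delta}.$$ 2. If the estimator is bounded and unbiased ($b(\theta)=0$ for all $\|\theta\|\le E$), then $md\le 4N(r\tau)^2\operatorname{Tr}V(\theta)$ for all $\|\theta\|\le E$. 3. If $m\ge1$ and the estimator is bounded with $\|b(\theta)\|\le\sqrt6\,\delta$ for all $\|\theta\|\le E$, then there is a $\theta$ with $\|\theta\|\le5\delta$ at which $b$ is differentiable, $\operatorname{Tr}[I+D(\theta)]>m/2$ and $md\le16N(r\tau)^2\operatorname{Tr}V(\theta)$. That is, a bias weakens the bound in 2 only by a factor of at most $4$. -/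

import Mathlib

open scoped BigOperators

noncomputable section

namespace HamEst

/-! ### Hamiltonian models -/

/-- A linear Hamiltonian model on `ℂ^d` with `m` parameters: Hermitian, traceless matrices
`X_1, …, X_m` that are orthonormal for the Hilbert-Schmidt inner product. -/
structure Model (d m : ℕ) where
  X : Fin m → Matrix (Fin d) (Fin d) ℂ
  hermitian : ∀ j, (X j).IsHermitian
  traceless : ∀ j, (X j).trace = 0
  orthonormal : ∀ j k, (X j * X k).trace = if j = k then 1 else 0

/-- The parameter space `ℝ^m` with the Euclidean norm. -/
abbrev Param (m : ℕ) : Type := EuclideanSpace ℝ (Fin m)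

namespace Model

variable {d m : ℕ}

/-- `H_θ = ∑_j θ^j X_j`. -/
def ham (S : Model d m) (θ : Param m) : Matrix (Fin d) (Fin d) ℂ :=
  ∑ j, (θ j : ℂ) • S.X j

/-- The model is spherical if `∑_j X_j²` is proportional to the identity. -/
def IsSpherical (S : Model d m) : Prop :=
  ∃ c : ℂ, ∑ j, S.X j * S.X j = c • (1 : Matrix (Fin d) (Fin d) ℂ)

/-- The unitary channel `e^{-i t H_θ}`. -/
def channel (S : Model d m) (θ : Param m) (t : ℝ) : Matrix (Fin d) (Fin d) ℂ :=
  NormedSpace.exp ((-(Complex.I * (t : ℂ))) • S.ham θ)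

end Model

/-! ### Hilbert spaces and tensor products

Every Hilbert space is, through an orthonormal basis, a space `ℓ²(ι)`, and then
`ℓ²(ι) ⊗ ℓ²(κ) = ℓ²(ι × κ)` and `ℓ²(ι)^{⊗ N} = ℓ²(Fin N → ι)`. -/

/-- The complex Hilbert space `ℓ²(ι)`; for finite `ι` it is `ℂ^ι`. -/
abbrev L2 (ι : Type*) : Type _ := lp (fun _ : ι => ℂ) 2

theorem memlp_ampliate {ι α : Type*} [Fintype ι] (A : Matrix ι ι ℂ) (ψ : L2 (ι × α)) :
    Memℓp (fun p : ι × α => ∑ j, A p.1 j * ψ (j, p.2)) 2 := by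
  have h0 : (0 : ℝ) < (2 : ENNReal).toReal := by norm_num
  have hψ : Summable fun p : ι × α => ‖ψ p‖ ^ (2 : ENNReal).toReal :=
    (memℓp_gen_iff h0).1 ψ.2
  refine Memℓp.finsetSum (p := 2) (f := fun j (p : ι × α) => A p.1 j * ψ (j, p.2)) Finset.univ ?_
  intro j _
  refine (memℓp_gen_iff h0).2 ?_
  have hj : Summable fun a : α => ‖ψ (j, a)‖ ^ (2 : ENNReal).toReal :=
    hψ.comp_injective (i := fun a : α => (j, a)) (fun a b h => (Prod.mk.inj h).2)
  have hA : Summable fun i : ι => ‖A i j‖ ^ (2 : ENNReal).toReal := (hasSum_fintype _).summable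
  refine (hA.mul_of_nonneg hj (fun i => by positivity) (fun a => by positivity)).congr ?_
  intro p
  simp [mul_pow]

/-- `(A ⊗ I) ψ` for a matrix `A` on `ℂ^ι` and `ψ ∈ ℂ^ι ⊗ ℓ²(α)`. -/
def ampliate {ι α : Type*} [Fintype ι] (A : Matrix ι ι ℂ) (ψ : L2 (ι × α)) : L2 (ι × α) :=
  ⟨fun p => ∑ j, A p.1 j * ψ (j, p.2), memlp_ampliate A ψ⟩

/-- The tensor power `A^{⊗ r}` of a matrix, acting on `(ℂ^d)^{⊗ r} = ℂ^(Fin r → Fin d)`. -/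
def tensorPowerMatrix {d : ℕ} (r : ℕ) (A : Matrix (Fin d) (Fin d) ℂ) :
    Matrix (Fin r → Fin d) (Fin r → Fin d) ℂ :=
  Matrix.of fun f g => ∏ i, A (f i) (g i)

theorem memlp_tensorPower {ι : Type*} (N : ℕ) (ψ : L2 ι) :
    Memℓp (fun f : Fin N → ι => ∏ i, ψ (f i)) 2 := by
  classical
  have h0 : (0 : ℝ) < (2 : ENNReal).toReal := by norm_num
  have hψ : Summable fun p : ι => ‖ψ p‖ ^ (2 : ENNReal).toReal := (memℓp_gen_iff h0).1 ψ.2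
  refine memℓp_gen' (C := (∑' p, ‖ψ p‖ ^ (2 : ENNReal).toReal) ^ N) ?_
  intro s
  set u : Finset ι := Finset.univ.biUnion fun i : Fin N => s.image fun f => f i with hu
  have hs : s ⊆ Fintype.piFinset fun _ : Fin N => u := by
    intro f hf
    refine Fintype.mem_piFinset.2 fun i => ?_
    exact Finset.mem_biUnion.2 ⟨i, Finset.mem_univ i, Finset.mem_image.2 ⟨f, hf, rfl⟩⟩
  calc ∑ f ∈ s, ‖∏ i, ψ (f i)‖ ^ (2 : ENNReal).toReal
      ≤ ∑ f ∈ Fintype.piFinset fun _ : Fin N => u, ‖∏ i, ψ (f i)‖ ^ (2 : ENNReal).toReal :=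
        Finset.sum_le_sum_of_subset_of_nonneg hs fun _ _ _ => by positivity
    _ = ∑ f ∈ Fintype.piFinset fun _ : Fin N => u, ∏ i, ‖ψ (f i)‖ ^ (2 : ENNReal).toReal := by
        refine Finset.sum_congr rfl fun f _ => ?_
        simp [norm_prod, Finset.prod_pow]
    _ = ∏ _i : Fin N, ∑ p ∈ u, ‖ψ p‖ ^ (2 : ENNReal).toReal :=
        (Finset.prod_univ_sum (fun _ : Fin N => u)
          fun _ p => ‖ψ p‖ ^ (2 : ENNReal).toReal).symm
    _ = (∑ p ∈ u, ‖ψ p‖ ^ (2 : ENNReal).toReal) ^ N := by simp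
    _ ≤ (∑' p, ‖ψ p‖ ^ (2 : ENNReal).toReal) ^ N := by
        refine pow_le_pow_left₀ (Finset.sum_nonneg fun _ _ => by positivity) ?_ N
        exact hψ.sum_le_tsum u fun _ _ => by positivity

/-- `ψ^{⊗ N}`: the state of `N` independent copies of a system in the state `ψ`. -/
def tensorPower {ι : Type*} (N : ℕ) (ψ : L2 ι) : L2 (Fin N → ι) :=
  ⟨fun f => ∏ i, ψ (f i), memlp_tensorPower N ψ⟩

/-! ### Quantum measurements -/

/-- A quantum measurement (positive operator valued measure) on the Hilbert space `K` with
outcomes in the measurable space `Ω`. -/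
structure POVM (Ω : Type*) [MeasurableSpace Ω] (K : Type*) [NormedAddCommGroup K]
    [InnerProductSpace ℂ K] where
  effect : Set Ω → K →L[ℂ] K
  pos : ∀ s, MeasurableSet s → (effect s).IsPositive
  total : effect Set.univ = 1
  additive : ∀ f : ℕ → Set Ω, (∀ i, MeasurableSet (f i)) → Pairwise (Function.onFun Disjoint f) →
    ∀ x y : K, HasSum (fun i => inner ℂ x (effect (f i) y)) (inner ℂ x (effect (⋃ i, f i) y))

namespace POVM

variable {Ω : Type*} [MeasurableSpace Ω] {K : Type*} [NormedAddCommGroup K]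
  [InnerProductSpace ℂ K]

theorem effect_empty (M : POVM Ω K) (x : K) : inner ℂ x (M.effect ∅ x) = 0 := by
  have h := M.additive (fun _ => ∅) (fun _ => MeasurableSet.empty)
    (fun _ _ _ => by simp [Function.onFun]) x x
  exact (summable_const_iff _).1 h.summable

theorem re_nonneg (M : POVM Ω K) {s : Set Ω} (hs : MeasurableSet s) (x : K) :
    0 ≤ (inner ℂ x (M.effect s x)).re :=
  (M.pos s hs).re_inner_nonneg_right x

/-- Born rule: the law of the outcome when the system is in the state `ψ`, which assigns
the probability `⟨ψ, M(s) ψ⟩` to every measurable set `s`. -/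
def law (M : POVM Ω K) (ψ : K) : MeasureTheory.Measure Ω :=
  MeasureTheory.Measure.ofMeasurable
    (fun s _ => ENNReal.ofReal (inner ℂ ψ (M.effect s ψ)).re)
    (by rw [M.effect_empty]; simp)
    (by
      intro f hf hd
      have h := Complex.hasSum_re (M.additive f hf hd ψ ψ)
      rw [← h.tsum_eq]
      exact ENNReal.ofReal_tsum_of_nonneg (fun i => M.re_nonneg (hf i) ψ) h.summable)

theorem law_apply (M : POVM Ω K) (ψ : K) {s : Set Ω} (hs : MeasurableSet s) :
    M.law ψ s = ENNReal.ofReal (inner ℂ ψ (M.effect s ψ)).re :=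
  MeasureTheory.Measure.ofMeasurable_apply s hs

end POVM

/-! ### Estimation procedures -/

/-- An estimation procedure for an `m`-parameter Hamiltonian on `ℂ^d`, with `r` driven channels,
an ancilla with Hilbert space `ℓ²(α)`, feedback control by `n` unitaries and `N` copies of the
probe state. Only `time 0, …, time n` and `control 0, …, control (n - 1)` are used.
The `N` copies are measured jointly, and the outcome `ω` yields the estimate `est ω`. -/
structure Procedure (d m : ℕ) (α : Type*) (Ω : Type*) [MeasurableSpace Ω] where
  r : ℕ
  n : ℕ
  N : ℕ
  init : L2 ((Fin r → Fin d) × α)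
  norm_init : ‖init‖ = 1
  time : ℕ → ℝ
  time_nonneg : ∀ k, 0 ≤ time k
  control : ℕ → (L2 ((Fin r → Fin d) × α) ≃ₗᵢ[ℂ] L2 ((Fin r → Fin d) × α))
  meas : POVM Ω (L2 (Fin N → (Fin r → Fin d) × α))
  est : Ω → Param m
  measurable_est : Measurable est

namespace Procedure

variable {d m : ℕ} {α : Type*} {Ω : Type*} [MeasurableSpace Ω]

/-- The driven evolution `U_r(t) = (e^{-i t H_θ})^{⊗ r} ⊗ I`. -/
def drive (P : Procedure d m α Ω) (S : Model d m) (θ : Param m) (t : ℝ)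
    (ψ : L2 ((Fin P.r → Fin d) × α)) : L2 ((Fin P.r → Fin d) × α) :=
  ampliate (tensorPowerMatrix P.r (S.channel θ t)) ψ

/-- `U_r(t_k) V_k ⋯ U_r(t_1) V_1 U_r(t_0) |q_ini⟩`, where `V_k = control (k - 1)`. -/
def stateAt (P : Procedure d m α Ω) (S : Model d m) (θ : Param m) :
    ℕ → L2 ((Fin P.r → Fin d) × α)
  | 0 => P.drive S θ (P.time 0) P.init
  | k + 1 => P.drive S θ (P.time (k + 1)) (P.control k (P.stateAt S θ k))

/-- The probe state `|q_θ⟩`. -/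
def probe (P : Procedure d m α Ω) (S : Model d m) (θ : Param m) :
    L2 ((Fin P.r → Fin d) × α) :=
  P.stateAt S θ P.n

/-- The evolution time `τ = t_0 + ⋯ + t_n` of a probe state. -/
def evolutionTime (P : Procedure d m α Ω) : ℝ :=
  ∑ k ∈ Finset.range (P.n + 1), P.time k

/-- The total time resource `T = N r τ`. -/
def totalTime (P : Procedure d m α Ω) : ℝ :=
  P.N * P.r * P.evolutionTime

/-- The law `ℙ_θ` of the outcome of the measurement on `|q_θ⟩^{⊗ N}`. -/
def law (P : Procedure d m α Ω) (S : Model d m) (θ : Param m) : MeasureTheory.Measure Ω :=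
  P.meas.law (tensorPower P.N (P.probe S θ))

/-- Successful estimation with tolerated error `δ` in the search radius `E`: the error exceeds
`δ` with probability at most `0.05`, for all `θ` in the search ball. -/
def Successful (P : Procedure d m α Ω) (S : Model d m) (δ E : ℝ) : Prop :=
  ∀ θ : Param m, ‖θ‖ ≤ E → P.law S θ {ω | δ < ‖P.est ω - θ‖} ≤ ENNReal.ofReal 0.05

/-- The estimator is bounded, so that its moments exist for every `θ`. -/
def BoundedEst (P : Procedure d m α Ω) : Prop :=
  ∃ K : ℝ, ∀ ω, ‖P.est ω‖ ≤ K

/-- `𝔼_θ[θ*]`. -/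
def mean (P : Procedure d m α Ω) (S : Model d m) (θ : Param m) : Param m :=
  ∫ ω, P.est ω ∂(P.law S θ)

/-- The bias `b(θ) = 𝔼_θ[θ*] - θ`. -/
def bias (P : Procedure d m α Ω) (S : Model d m) (θ : Param m) : Param m :=
  P.mean S θ - θ

/-- The covariance matrix `V(θ)` of the estimator. -/
def cov (P : Procedure d m α Ω) (S : Model d m) (θ : Param m) : Matrix (Fin m) (Fin m) ℝ :=
  Matrix.of fun j k =>
    ∫ ω, (P.est ω j - P.mean S θ j) * (P.est ω k - P.mean S θ k) ∂(P.law S θ)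

/-- The matrix `D(θ)` with entries `∂_j b_k(θ)`. -/
def biasDeriv (P : Procedure d m α Ω) (S : Model d m) (θ : Param m) :
    Matrix (Fin m) (Fin m) ℝ :=
  Matrix.of fun j k => (fderiv ℝ (P.bias S) θ (EuclideanSpace.single j 1)) k

end Procedure

end HamEst

end

/-!
All three claims rest on an information inequality for the divergence of `θ ↦ 𝔼_θ[θ*]`, which
is `Tr[I + D(θ)]`:
`Tr[I + D(θ)] ≤ 2 √(N (rτ)² (m/d) Tr V(θ))`
(`Procedure.BoundedEst.divergence_mean_le`). It combines two estimates.

* The derivatives `∂_j q_θ` of the probe state satisfy `∑_j ‖∂_j q_θ‖² ≤ (rτ)² m/d`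
  (`Procedure.sum_norm_partials_probe_sq_le`). The norm of a column `(∂_j W)_j` is subadditive under
  products of unitaries, so every channel contributes at most its evolution time multiplied by
  the norm of the column `(X_j)_j`, and for a spherical model this norm is `√(m/d)`. Controls,
  ancilla and tensor factors are isometric and do not contribute. For `N` copies only the
  component of the derivative orthogonal to the state counts, and its square norm is additive
  (`norm_horizontal_partials_tensorPower_sq`).
* For a bounded function `f` of the outcome with the observable `M(f) = ∫ f dM`, the derivative of
  the expectation is `2 Re⟨∂_j ψ, M(f) ψ⟩`. Here `f` may be centred and `∂_j ψ` replaced by its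
  orthogonal component, and `M(f)² ≤ M(f²)` bounds the result by the standard deviation of `f`
  (`POVM.partials_integral_law_le`). The real part of the form `⟨x, M(f) y⟩` is obtained by
  polarization from the laws of the outcome, and each of its properties from the corresponding
  property of the effects by approximating `f` with simple functions
  (`sum_integral_comp_nonneg`).

For an unbiased estimator `Tr[I + D] = m`. If the bias is at most `√6 δ` on the ball of radius
`5δ`, its mean divergence there is at least `-(√6/5) m`, hence above `-m/2` at some point
(`exists_divergence_gt`). A successful estimator, projected to the ball of radius `5δ`, has mean
square error at most `6δ²`. This bounds both its bias and its variance, and the time bound follows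
because `N ≤ N²`.
-/

noncomputable section

namespace HamEst

section Matrices

/-! ### Columns of matrices and their norms -/

open Matrix
open scoped Matrix.Norms.L2Operator Kronecker

variable {ι κ J : Type*}

/-- The matrices `B j`, stacked on top of each other into a single tall matrix. Its operator norm
is the norm of the column `(B j)_j` as a map from `ℂ^κ` to the direct sum of copies of `ℂ^ι`. -/
def stack (B : J → Matrix ι κ ℂ) : Matrix (J × ι) κ ℂ :=
  Matrix.of fun p b => B p.1 p.2 b

theorem stack_add (B C : J → Matrix ι κ ℂ) : stack (B + C) = stack B + stack C := rfl

theorem stack_conjTranspose_mul_self [Fintype ι] [Fintype J] (B : J → Matrix ι κ ℂ) :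
    (stack B)ᴴ * stack B = ∑ j, (B j)ᴴ * B j := by
  ext a b
  simp [stack, Matrix.mul_apply, Fintype.sum_prod_type, Matrix.sum_apply]

variable [Fintype ι] [Fintype κ] [Fintype J] [DecidableEq κ]

theorem norm_stack_sq (B : J → Matrix ι κ ℂ) :
    ‖stack B‖ ^ 2 = ‖∑ j, (B j)ᴴ * B j‖ := by
  rw [← stack_conjTranspose_mul_self, l2_opNorm_conjTranspose_mul_self, sq]

theorem norm_stack_mul_right_le (B : J → Matrix ι κ ℂ) (W : Matrix κ κ ℂ) :
    ‖stack fun j => B j * W‖ ≤ ‖stack B‖ * ‖W‖ := by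
  have h : (stack fun j => B j * W) = stack B * W := by
    ext p b
    simp [stack, Matrix.mul_apply]
  rw [h]
  exact l2_opNorm_mul _ _

theorem norm_unitary_le_one {W : Matrix κ κ ℂ} (hW : W ∈ unitary (Matrix κ κ ℂ)) : ‖W‖ ≤ 1 := by
  rcases subsingleton_or_nontrivial (Matrix κ κ ℂ) with _ | _
  · simp [Subsingleton.elim W 0]
  · exact (CStarRing.norm_of_mem_unitary hW).le

theorem sum_norm_mulVec_sq_le (B : J → Matrix ι κ ℂ) (v : κ → ℂ) :
    ∑ j, ∑ i, ‖(B j *ᵥ v) i‖ ^ 2 ≤ ‖stack B‖ ^ 2 * ∑ i, ‖v i‖ ^ 2 := by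
  have h := l2_opNorm_mulVec (stack B) (WithLp.toLp 2 v)
  have h2 := pow_le_pow_left₀ (norm_nonneg _) h 2
  rw [mul_pow, EuclideanSpace.norm_sq_eq, EuclideanSpace.norm_sq_eq, Fintype.sum_prod_type] at h2
  exact h2

variable [DecidableEq ι]

theorem norm_stack_mul_left (B : J → Matrix ι ι ℂ) {W : Matrix ι ι ℂ}
    (hW : W ∈ unitary (Matrix ι ι ℂ)) : ‖stack fun j => W * B j‖ = ‖stack B‖ := by
  refine (sq_eq_sq₀ (norm_nonneg _) (norm_nonneg _)).1 ?_
  have hW' : Wᴴ * W = 1 := (Unitary.mem_iff.1 hW).1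
  rw [norm_stack_sq, norm_stack_sq]
  congr 1
  refine Finset.sum_congr rfl fun j _ => ?_
  rw [conjTranspose_mul, mul_assoc, ← mul_assoc Wᴴ, hW', one_mul]

/-- A star homomorphism of C⋆-algebras is contractive, also on columns. -/
theorem norm_stack_map_le (π : Matrix ι ι ℂ →⋆ₐ[ℂ] Matrix κ κ ℂ) (B : J → Matrix ι ι ℂ) :
    ‖stack fun j => π (B j)‖ ≤ ‖stack B‖ := by
  refine (sq_le_sq₀ (norm_nonneg _) (norm_nonneg _)).1 ?_
  rw [norm_stack_sq, norm_stack_sq]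
  have h : ∑ j, (π (B j))ᴴ * π (B j) = π (∑ j, (B j)ᴴ * B j) := by
    rw [map_sum]
    refine Finset.sum_congr rfl fun j _ => ?_
    rw [map_mul, ← star_eq_conjTranspose, ← star_eq_conjTranspose, map_star]
  rw [h]
  exact NonUnitalStarAlgHom.norm_apply_le π _

variable {m : ℕ}

/-- The partial derivative `∂_j W` at `θ`; without the last argument, the column of all of them. -/
def partials {F : Type*} [NormedAddCommGroup F] [NormedSpace ℝ F] (W : Param m → F)
    (θ : Param m) (j : Fin m) : F :=
  fderiv ℝ W θ (EuclideanSpace.single j 1)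

/-- The norm of the column of derivatives is subadditive under products of unitaries, which are
isometric. All bounds on derivatives of evolutions are instances of this. -/
theorem norm_stack_partials_mul_le {W₁ W₂ : Param m → Matrix ι ι ℂ} {θ : Param m}
    (h₁ : DifferentiableAt ℝ W₁ θ) (h₂ : DifferentiableAt ℝ W₂ θ)
    (u₁ : W₁ θ ∈ unitary (Matrix ι ι ℂ)) (u₂ : W₂ θ ∈ unitary (Matrix ι ι ℂ)) :
    ‖stack (partials (fun η => W₁ η * W₂ η) θ)‖ ≤
      ‖stack (partials W₁ θ)‖ + ‖stack (partials W₂ θ)‖ := by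
  have h : partials (fun η => W₁ η * W₂ η) θ =
      (fun j => W₁ θ * partials W₂ θ j) + fun j => partials W₁ θ j * W₂ θ := by
    funext j
    simp [partials, fderiv_fun_mul' h₁ h₂]
  have hu : ‖W₂ θ‖ ≤ 1 := norm_unitary_le_one u₂
  rw [h, stack_add]
  refine (norm_add_le _ _).trans ?_
  rw [norm_stack_mul_left _ u₁, add_comm]
  gcongr
  refine (norm_stack_mul_right_le _ _).trans ?_
  exact mul_le_of_le_one_right (norm_nonneg _) hu

theorem norm_stack_partials_pow_le {W : Param m → Matrix ι ι ℂ} {θ : Param m}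
    (h : DifferentiableAt ℝ W θ) (u : W θ ∈ unitary (Matrix ι ι ℂ)) (n : ℕ) :
    ‖stack (partials (fun η => W η ^ n) θ)‖ ≤ n * ‖stack (partials W θ)‖ := by
  induction n with
  | zero =>
    have h0 : stack (partials (fun η => W η ^ 0) θ) = 0 := by
      ext p b
      simp [stack, partials]
    rw [h0]
    simp
  | succ n ih =>
    simp only [pow_succ]
    refine (norm_stack_partials_mul_le (h.fun_pow n) h (pow_mem u n) u).trans ?_
    push_cast
    linarith

/-! ### The derivative of the driven channel -/

namespace Model

variable {d : ℕ} (S : Model d m)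

theorem ham_isHermitian (θ : Param m) : (S.ham θ).IsHermitian := by
  unfold ham
  rw [IsHermitian, conjTranspose_sum]
  refine Finset.sum_congr rfl fun j _ => ?_
  rw [conjTranspose_smul, (S.hermitian j).eq]
  simp

/-- `θ ↦ H_θ` as a continuous linear map. -/
def hamL : Param m →L[ℝ] Matrix (Fin d) (Fin d) ℂ :=
  ∑ j, (EuclideanSpace.proj j : Param m →L[ℝ] ℝ).smulRight (S.X j)

theorem coe_hamL : ⇑S.hamL = S.ham := by
  funext η
  simp only [hamL, ham, _root_.sum_apply, ContinuousLinearMap.smulRight_apply]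
  rfl

theorem hamL_single (j : Fin m) : S.hamL (EuclideanSpace.single j 1) = S.X j := by
  rw [coe_hamL, ham, Finset.sum_eq_single_of_mem j (Finset.mem_univ j)]
  · simp
  · intro k _ hk
    simp [hk]

theorem contDiff_ham : ContDiff ℝ 1 S.ham := by
  rw [← coe_hamL]
  exact S.hamL.contDiff

theorem channel_mem_unitary (θ : Param m) (t : ℝ) :
    S.channel θ t ∈ unitary (Matrix (Fin d) (Fin d) ℂ) := by
  let _ : NormedAlgebra ℚ (Matrix (Fin d) (Fin d) ℂ) := NormedAlgebra.restrictScalars ℚ ℂ _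
  refine NormedSpace.exp_mem_unitary_of_mem_skewAdjoint ?_
  rw [skewAdjoint.mem_iff, star_eq_conjTranspose, conjTranspose_smul, (S.ham_isHermitian θ).eq]
  simp

theorem contDiff_exp : ContDiff ℂ 1 (NormedSpace.exp : Matrix (Fin d) (Fin d) ℂ → _) :=
  contDiff_iff_contDiffAt.2 fun x => (NormedSpace.exp_analytic x).contDiffAt

theorem contDiff_channel (t : ℝ) : ContDiff ℝ 1 fun θ => S.channel θ t := by
  unfold channel
  exact (contDiff_exp.restrict_scalars ℝ).comp (S.contDiff_ham.const_smul _)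

theorem channel_eq_pow (θ : Param m) (t : ℝ) {n : ℕ} (hn : n ≠ 0) :
    S.channel θ t = S.channel θ (t / n) ^ n := by
  unfold channel
  rw [← Matrix.exp_nsmul, ← Nat.cast_smul_eq_nsmul ℂ, smul_smul]
  congr 2
  have : (n : ℂ) ≠ 0 := by exact_mod_cast hn
  push_cast
  field_simp

theorem partials_channel (θ : Param m) (t : ℝ) : partials (fun η => S.channel η t) θ =
    fun j => (-(Complex.I * (t : ℂ))) •
      fderiv ℂ NormedSpace.exp ((-(Complex.I * (t : ℂ))) • S.ham θ) (S.X j) := by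
  funext j
  have h1 := ((contDiff_exp (d := d)).differentiable one_ne_zero
    ((-(Complex.I * (t : ℂ))) • S.ham θ)).hasFDerivAt.restrictScalars ℝ
  have h0 : HasFDerivAt S.ham S.hamL θ := by
    rw [← coe_hamL]
    exact S.hamL.hasFDerivAt
  have h2 := h1.comp θ (h0.const_smul (-(Complex.I * (t : ℂ))))
  unfold partials channel
  refine (congrArg (fun L => L (EuclideanSpace.single j (1 : ℝ))) h2.fderiv).trans ?_
  simp [S.hamL_single]

theorem norm_stack_partials_channel_eq (θ : Param m) {t : ℝ} (ht : 0 ≤ t) :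
    ‖stack (partials (fun η => S.channel η t) θ)‖ = t * ‖stack fun j =>
      fderiv ℂ NormedSpace.exp ((-(Complex.I * (t : ℂ))) • S.ham θ) (S.X j)‖ := by
  rw [partials_channel]
  have h : (stack fun j => (-(Complex.I * (t : ℂ))) •
      fderiv ℂ NormedSpace.exp ((-(Complex.I * (t : ℂ))) • S.ham θ) (S.X j)) =
      (-(Complex.I * (t : ℂ))) • stack fun j =>
        fderiv ℂ NormedSpace.exp ((-(Complex.I * (t : ℂ))) • S.ham θ) (S.X j) := rfl
  rw [h, norm_smul]
  simp [abs_of_nonneg ht]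

/-- The derivative of `e^{-itH_θ}` is controlled without a formula for it: `e^{-itH_θ}` is the
`n`-th power of `e^{-i(t/n)H_θ}`, whose derivative is `-i(t/n) X_j` up to terms of lower order. -/
theorem norm_stack_partials_channel_le (θ : Param m) {t : ℝ} (ht : 0 ≤ t) :
    ‖stack (partials (fun η => S.channel η t) θ)‖ ≤ t * ‖stack S.X‖ := by
  -- By continuity of the derivative of `exp`, which is the identity at `0`.
  have hs : Continuous fun s : ℝ => ‖stack fun j =>
      fderiv ℂ NormedSpace.exp ((-(Complex.I * (s : ℂ))) • S.ham θ) (S.X j)‖ := by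
    refine continuous_norm.comp (continuous_matrix fun p b => ?_)
    have h1 : Continuous fun s : ℝ =>
        fderiv ℂ NormedSpace.exp ((-(Complex.I * (s : ℂ))) • S.ham θ) (S.X p.1) :=
      ((contDiff_exp.continuous_fderiv one_ne_zero).comp (by fun_prop)).clm_apply continuous_const
    exact h1.matrix_elem p.2 b
  have hlim : Filter.Tendsto (fun n : ℕ => t * ‖stack fun j => fderiv ℂ NormedSpace.exp
      ((-(Complex.I * ((t / n : ℝ) : ℂ))) • S.ham θ) (S.X j)‖) Filter.atTop
      (nhds (t * ‖stack S.X‖)) := by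
    have h0 := hs.tendsto 0
    have h1 : (stack fun j => fderiv ℂ NormedSpace.exp
        ((-(Complex.I * ((0 : ℝ) : ℂ))) • S.ham θ) (S.X j)) = stack S.X := by
      congr 1
      funext j
      simp [(hasFDerivAt_exp_zero (𝕂 := ℂ) (𝔸 := Matrix (Fin d) (Fin d) ℂ)).fderiv]
    rw [h1] at h0
    exact (h0.comp (tendsto_const_div_atTop_nhds_zero_nat t)).const_mul t
  refine ge_of_tendsto hlim (Filter.eventually_atTop.2 ⟨1, fun n hn => ?_⟩)
  have hn0 : n ≠ 0 := by omega
  have hn' : (n : ℝ) ≠ 0 := by exact_mod_cast hn0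
  have hp : (fun η => S.channel η t) = fun η => S.channel η (t / n) ^ n :=
    funext fun η => S.channel_eq_pow η t hn0
  rw [hp]
  refine (norm_stack_partials_pow_le ((S.contDiff_channel _).differentiable one_ne_zero θ)
    (S.channel_mem_unitary θ _) n).trans ?_
  rw [S.norm_stack_partials_channel_eq θ (by positivity), ← mul_assoc, mul_div_cancel₀ _ hn']

/-- In a spherical model `∑_j X_j²` is `m / d` times the identity, by comparison of traces. -/
theorem norm_stack_X_le (hS : S.IsSpherical) : ‖stack S.X‖ ≤ Real.sqrt (m / d) := by
  refine Real.le_sqrt_of_sq_le ?_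
  obtain ⟨c, hc⟩ := hS
  rw [norm_stack_sq]
  have h : ∑ j, (S.X j)ᴴ * S.X j = c • (1 : Matrix (Fin d) (Fin d) ℂ) := by
    rw [← hc]
    exact Finset.sum_congr rfl fun j _ => by rw [(S.hermitian j).eq]
  rw [h, norm_smul]
  rcases Nat.eq_zero_or_pos d with rfl | hd
  · simp [Subsingleton.elim (1 : Matrix (Fin 0) (Fin 0) ℂ) 0]
  · have ht := congrArg Matrix.trace hc
    rw [trace_sum, trace_smul, trace_one] at ht
    simp only [S.orthonormal, if_true, Finset.sum_const, Finset.card_univ, Fintype.card_fin,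
      smul_eq_mul, nsmul_eq_mul, mul_one] at ht
    have hd' : (d : ℂ) ≠ 0 := by exact_mod_cast hd.ne'
    have hcm : c = m / d := by rw [ht]; field_simp
    rw [hcm]
    refine (mul_le_of_le_one_right (norm_nonneg _) (norm_unitary_le_one (one_mem _))).trans ?_
    simp

end Model

/-! ### Tensor powers of matrices -/

/-- `A ↦ A ⊗ I`, with `ℂ^ι ⊗ ℂ^κ` identified with `ℂ^μ` along `e`. -/
def leftTensor {μ : Type*} [Fintype μ] [DecidableEq μ] (e : μ ≃ ι × κ) :
    Matrix ι ι ℂ →⋆ₐ[ℂ] Matrix μ μ ℂ where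
  toFun A := (A ⊗ₖ (1 : Matrix κ κ ℂ)).submatrix e e
  map_one' := by simp
  map_mul' A B := by
    rw [submatrix_mul_equiv, ← mul_kronecker_mul, one_mul]
  map_zero' := by simp
  map_add' A B := by rw [add_kronecker]; rfl
  commutes' c := by
    ext x y
    simp [algebraMap_eq_diagonal, diagonal_apply, one_apply, ← ite_and, and_comm, ← Prod.ext_iff]
  map_star' A := by
    simp [star_eq_conjTranspose, conjTranspose_kronecker]

/-- `B ↦ I ⊗ B`, with `ℂ^ι ⊗ ℂ^κ` identified with `ℂ^μ` along `e`. -/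
def rightTensor {μ : Type*} [Fintype μ] [DecidableEq μ] (e : μ ≃ ι × κ) :
    Matrix κ κ ℂ →⋆ₐ[ℂ] Matrix μ μ ℂ where
  toFun B := ((1 : Matrix ι ι ℂ) ⊗ₖ B).submatrix e e
  map_one' := by simp
  map_mul' A B := by
    rw [submatrix_mul_equiv, ← mul_kronecker_mul, one_mul]
  map_zero' := by simp
  map_add' A B := by rw [kronecker_add]; rfl
  commutes' c := by
    ext x y
    simp [algebraMap_eq_diagonal, diagonal_apply, one_apply, ← ite_and, and_comm, ← Prod.ext_iff]
  map_star' A := by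
    simp [star_eq_conjTranspose, conjTranspose_kronecker]

theorem norm_stack_partials_map_le (π : Matrix ι ι ℂ →⋆ₐ[ℂ] Matrix κ κ ℂ)
    {W : Param m → Matrix ι ι ℂ} {θ : Param m} (h : DifferentiableAt ℝ W θ) :
    ‖stack (partials (fun η => π (W η)) θ)‖ ≤ ‖stack (partials W θ)‖ := by
  let L : Matrix ι ι ℂ →L[ℝ] Matrix κ κ ℂ :=
    (LinearMap.toContinuousLinearMap (π.toAlgHom.toLinearMap)).restrictScalars ℝ
  have hL : partials (fun η => π (W η)) θ = fun j => π (partials W θ j) := by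
    funext j
    exact congrArg (fun A => A (EuclideanSpace.single j (1 : ℝ)))
      (L.hasFDerivAt.comp θ h.hasFDerivAt).fderiv
  rw [hL]
  exact norm_stack_map_le π _

theorem contDiff_starAlgHom_comp (π : Matrix ι ι ℂ →⋆ₐ[ℂ] Matrix κ κ ℂ)
    {W : Param m → Matrix ι ι ℂ} (h : ContDiff ℝ 1 W) : ContDiff ℝ 1 fun η => π (W η) := by
  let L : Matrix ι ι ℂ →L[ℝ] Matrix κ κ ℂ :=
    (LinearMap.toContinuousLinearMap (π.toAlgHom.toLinearMap)).restrictScalars ℝ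
  exact L.contDiff.comp h

/-- `ι^(r+1)` as `ι × ι^r`, by splitting off the first coordinate. -/
def splitFirst (ι : Type*) (r : ℕ) : (Fin (r + 1) → ι) ≃ ι × (Fin r → ι) :=
  (Fin.consEquiv fun _ => ι).symm

theorem tensorPowerMatrix_zero {d : ℕ} (A : Matrix (Fin d) (Fin d) ℂ) :
    tensorPowerMatrix 0 A = 1 := by
  ext f g
  rw [Subsingleton.elim f g]
  simp [tensorPowerMatrix]

/-- `A^{⊗(r+1)} = (A ⊗ I) (I ⊗ A^{⊗ r})`, a product of images of star homomorphisms. -/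
theorem tensorPowerMatrix_succ {d : ℕ} (r : ℕ) (A : Matrix (Fin d) (Fin d) ℂ) :
    tensorPowerMatrix (r + 1) A = leftTensor (splitFirst (Fin d) r) A *
      rightTensor (splitFirst (Fin d) r) (tensorPowerMatrix r A) := by
  have h : leftTensor (splitFirst (Fin d) r) A *
      rightTensor (splitFirst (Fin d) r) (tensorPowerMatrix r A) =
      (A ⊗ₖ tensorPowerMatrix r A).submatrix (splitFirst (Fin d) r) (splitFirst (Fin d) r) := by
    change (A ⊗ₖ (1 : Matrix (Fin r → Fin d) (Fin r → Fin d) ℂ)).submatrix _ _ *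
      ((1 : Matrix (Fin d) (Fin d) ℂ) ⊗ₖ tensorPowerMatrix r A).submatrix _ _ = _
    rw [submatrix_mul_equiv, ← mul_kronecker_mul, one_mul, mul_one]
  rw [h]
  ext f g
  simp [tensorPowerMatrix, splitFirst, Fin.prod_univ_succ, Fin.tail]

theorem tensorPowerMatrix_mem_unitary {d : ℕ} (r : ℕ) {A : Matrix (Fin d) (Fin d) ℂ}
    (hA : A ∈ unitary (Matrix (Fin d) (Fin d) ℂ)) :
    tensorPowerMatrix r A ∈ unitary (Matrix (Fin r → Fin d) (Fin r → Fin d) ℂ) := by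
  induction r with
  | zero => rw [tensorPowerMatrix_zero]; exact one_mem _
  | succ r ih =>
    rw [tensorPowerMatrix_succ]
    exact mul_mem (Unitary.map_mem _ hA) (Unitary.map_mem _ ih)

theorem contDiff_tensorPowerMatrix {d : ℕ} (r : ℕ) {W : Param m → Matrix (Fin d) (Fin d) ℂ}
    (h : ContDiff ℝ 1 W) : ContDiff ℝ 1 fun η => tensorPowerMatrix r (W η) := by
  induction r with
  | zero =>
    simp only [tensorPowerMatrix_zero]
    exact contDiff_const
  | succ r ih =>
    simp only [tensorPowerMatrix_succ]
    exact (contDiff_starAlgHom_comp _ h).mul (contDiff_starAlgHom_comp _ ih)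

theorem norm_stack_partials_tensorPowerMatrix_le {d : ℕ} (r : ℕ)
    {W : Param m → Matrix (Fin d) (Fin d) ℂ} (h : ContDiff ℝ 1 W) {θ : Param m}
    (u : W θ ∈ unitary (Matrix (Fin d) (Fin d) ℂ)) :
    ‖stack (partials (fun η => tensorPowerMatrix r (W η)) θ)‖ ≤ r * ‖stack (partials W θ)‖ := by
  induction r with
  | zero =>
    have h0 : stack (partials (fun η => tensorPowerMatrix 0 (W η)) θ) = 0 := by
      ext p b
      simp [stack, partials, tensorPowerMatrix_zero]
    rw [h0]
    simp
  | succ r ih =>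
    simp only [tensorPowerMatrix_succ]
    have h1 := (contDiff_starAlgHom_comp (leftTensor (splitFirst (Fin d) r)) h).differentiable
      one_ne_zero θ
    have h2 := (contDiff_starAlgHom_comp (rightTensor (splitFirst (Fin d) r))
      (contDiff_tensorPowerMatrix r h)).differentiable one_ne_zero θ
    refine (norm_stack_partials_mul_le h1 h2 (Unitary.map_mem _ u)
      (Unitary.map_mem _ (tensorPowerMatrix_mem_unitary r u))).trans ?_
    have h3 := norm_stack_partials_map_le (leftTensor (splitFirst (Fin d) r))
      (h.differentiable one_ne_zero θ)
    have h4 := norm_stack_partials_map_le (rightTensor (splitFirst (Fin d) r))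
      ((contDiff_tensorPowerMatrix r h).differentiable one_ne_zero θ)
    push_cast
    linarith

end Matrices

section Probe

open Matrix
open scoped Matrix.Norms.L2Operator

/-! ### The probe state and its derivative -/

theorem hasSum_norm_sq {ι : Type*} (ψ : L2 ι) : HasSum (fun p => ‖ψ p‖ ^ 2) (‖ψ‖ ^ 2) := by
  have h := lp.hasSum_norm (p := 2) (by norm_num) ψ
  simpa using h

section Ampliate

variable {ι α J : Type*} [Fintype ι]

theorem hasSum_fiber_norm_sq (ψ : L2 (ι × α)) :
    HasSum (fun a => ∑ i, ‖ψ (i, a)‖ ^ 2) (‖ψ‖ ^ 2) :=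
  ((Equiv.prodComm α ι).hasSum_iff.2 (hasSum_norm_sq ψ)).prod_fiberwise fun _ => hasSum_fintype _

theorem sum_norm_ampliate_sq_le [Fintype J] [DecidableEq ι] (B : J → Matrix ι ι ℂ)
    (ψ : L2 (ι × α)) :
    ∑ j, ‖ampliate (B j) ψ‖ ^ 2 ≤ (‖stack B‖ * ‖ψ‖) ^ 2 := by
  rw [mul_pow]
  -- For each index `a` of the ancilla this is an inequality for vectors in `ℂ^ι`.
  refine hasSum_le (fun a => ?_) (hasSum_sum fun j _ => hasSum_fiber_norm_sq (ampliate (B j) ψ))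
    ((hasSum_fiber_norm_sq ψ).mul_left _)
  exact sum_norm_mulVec_sq_le B fun i => ψ (i, a)

theorem norm_ampliate_le [DecidableEq ι] (A : Matrix ι ι ℂ) (ψ : L2 (ι × α)) :
    ‖ampliate A ψ‖ ≤ ‖A‖ * ‖ψ‖ := by
  have h := sum_norm_ampliate_sq_le (fun _ : Unit => A) ψ
  have hA : ‖stack fun _ : Unit => A‖ = ‖A‖ := by
    refine (sq_eq_sq₀ (norm_nonneg _) (norm_nonneg _)).1 ?_
    rw [norm_stack_sq]
    simp [l2_opNorm_conjTranspose_mul_self, sq]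
  rw [hA] at h
  refine (sq_le_sq₀ (norm_nonneg _) (by positivity)).1 ?_
  simpa using h

theorem ampliate_apply (A : Matrix ι ι ℂ) (ψ : L2 (ι × α)) (p : ι × α) :
    ampliate A ψ p = ∑ j, A p.1 j * ψ (j, p.2) := rfl

theorem ampliate_one [DecidableEq ι] (ψ : L2 (ι × α)) : ampliate 1 ψ = ψ := by
  ext p
  simp [ampliate_apply, one_apply]

theorem ampliate_ampliate (A B : Matrix ι ι ℂ) (ψ : L2 (ι × α)) :
    ampliate A (ampliate B ψ) = ampliate (A * B) ψ := by
  ext p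
  simp only [ampliate_apply, mul_apply, Finset.mul_sum, Finset.sum_mul]
  rw [Finset.sum_comm]
  simp only [mul_assoc]

theorem norm_ampliate_unitary [DecidableEq ι] {W : Matrix ι ι ℂ}
    (hW : W ∈ unitary (Matrix ι ι ℂ)) (ψ : L2 (ι × α)) : ‖ampliate W ψ‖ = ‖ψ‖ := by
  have key : ∀ V ∈ unitary (Matrix ι ι ℂ), ∀ φ : L2 (ι × α), ‖ampliate V φ‖ ≤ ‖φ‖ :=
    fun V hV φ => (norm_ampliate_le V φ).trans
      (mul_le_of_le_one_left (norm_nonneg _) (norm_unitary_le_one hV))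
  refine le_antisymm (key W hW ψ) ?_
  have h := key _ (Unitary.star_mem hW) (ampliate W ψ)
  rwa [ampliate_ampliate, (Unitary.mem_iff.1 hW).1, ampliate_one] at h

/-- `(A, ψ) ↦ (A ⊗ I) ψ` as a continuous bilinear map. -/
def ampliateL (ι α : Type*) [Fintype ι] [DecidableEq ι] :
    Matrix ι ι ℂ →L[ℝ] L2 (ι × α) →L[ℝ] L2 (ι × α) :=
  LinearMap.mkContinuous₂
    (LinearMap.mk₂ ℝ ampliate
      (fun A B ψ => by ext p; simp [ampliate_apply, add_mul, Finset.sum_add_distrib])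
      (fun c A ψ => by ext p; simp [ampliate_apply, Finset.mul_sum, mul_assoc])
      (fun A ψ φ => by ext p; simp [ampliate_apply, mul_add, Finset.sum_add_distrib])
      (fun c A ψ => by ext p; simp [ampliate_apply, Finset.mul_sum, mul_left_comm]))
    1 fun A ψ => by simpa using norm_ampliate_le A ψ

theorem ampliateL_apply [DecidableEq ι] (A : Matrix ι ι ℂ) (ψ : L2 (ι × α)) :
    ampliateL ι α A ψ = ampliate A ψ := rfl

end Ampliate

/-- Minkowski's inequality for finite families of vectors. -/
theorem sqrt_sum_norm_add_sq_le {F : Type*} [NormedAddCommGroup F] {J : Type*} [Fintype J]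
    (x y : J → F) : Real.sqrt (∑ j, ‖x j + y j‖ ^ 2) ≤
      Real.sqrt (∑ j, ‖x j‖ ^ 2) + Real.sqrt (∑ j, ‖y j‖ ^ 2) := by
  have h := norm_add_le (WithLp.toLp 2 x : PiLp 2 fun _ : J => F) (WithLp.toLp 2 y)
  rw [PiLp.norm_eq_of_L2, PiLp.norm_eq_of_L2, PiLp.norm_eq_of_L2] at h
  exact h

variable {d m : ℕ} {α : Type*}

theorem sqrt_sum_partials_ampliate_le {ι : Type*} [Fintype ι] [DecidableEq ι]
    {W : Param m → Matrix ι ι ℂ} {φ : Param m → L2 (ι × α)} {θ : Param m}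
    (hW : DifferentiableAt ℝ W θ) (hφ : DifferentiableAt ℝ φ θ)
    (u : W θ ∈ unitary (Matrix ι ι ℂ)) (n : ‖φ θ‖ = 1) :
    Real.sqrt (∑ j, ‖partials (fun η => ampliate (W η) (φ η)) θ j‖ ^ 2) ≤
      ‖stack (partials W θ)‖ + Real.sqrt (∑ j, ‖partials φ θ j‖ ^ 2) := by
  have h : ∀ j, partials (fun η => ampliate (W η) (φ η)) θ j =
      ampliate (partials W θ j) (φ θ) + ampliate (W θ) (partials φ θ j) := by
    intro j
    have h := (ampliateL ι α).hasFDerivAt_of_bilinear hW.hasFDerivAt hφ.hasFDerivAt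
    refine (congrArg (fun L => L (EuclideanSpace.single j (1 : ℝ))) h.fderiv).trans ?_
    simp [partials, ampliateL_apply, add_comm]
  simp only [h]
  refine (sqrt_sum_norm_add_sq_le _ _).trans ?_
  simp only [norm_ampliate_unitary u]
  gcongr
  refine Real.sqrt_le_iff.2 ⟨norm_nonneg _, ?_⟩
  simpa [n] using sum_norm_ampliate_sq_le (partials W θ) (φ θ)

namespace Procedure

variable {Ω : Type*} [MeasurableSpace Ω] (P : Procedure d m α Ω) (S : Model d m)

theorem driveMatrix_mem_unitary (θ : Param m) (t : ℝ) :
    tensorPowerMatrix P.r (S.channel θ t) ∈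
      unitary (Matrix (Fin P.r → Fin d) (Fin P.r → Fin d) ℂ) :=
  tensorPowerMatrix_mem_unitary _ (S.channel_mem_unitary θ t)

theorem norm_stateAt (θ : Param m) (k : ℕ) : ‖P.stateAt S θ k‖ = 1 := by
  induction k with
  | zero =>
    exact (norm_ampliate_unitary (P.driveMatrix_mem_unitary S θ _) _).trans P.norm_init
  | succ k ih =>
    refine (norm_ampliate_unitary (P.driveMatrix_mem_unitary S θ _) _).trans ?_
    rw [LinearIsometryEquiv.norm_map, ih]

theorem contDiff_drive (t : ℝ) {φ : Param m → L2 ((Fin P.r → Fin d) × α)}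
    (hφ : ContDiff ℝ 1 φ) : ContDiff ℝ 1 fun θ => P.drive S θ t (φ θ) :=
  ((ampliateL (Fin P.r → Fin d) α).contDiff.comp
    (contDiff_tensorPowerMatrix P.r (S.contDiff_channel t))).clm_apply hφ

theorem contDiff_control_comp (k : ℕ) {φ : Param m → L2 ((Fin P.r → Fin d) × α)}
    (hφ : ContDiff ℝ 1 φ) : ContDiff ℝ 1 fun θ => P.control k (φ θ) :=
  ((P.control k).toContinuousLinearEquiv.toContinuousLinearMap.restrictScalars
    ℝ).contDiff.comp hφ

theorem contDiff_stateAt (k : ℕ) : ContDiff ℝ 1 fun θ => P.stateAt S θ k := by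
  induction k with
  | zero => exact P.contDiff_drive S _ contDiff_const
  | succ k ih => exact P.contDiff_drive S _ (P.contDiff_control_comp k ih)

theorem partials_control_comp (k : ℕ) {φ : Param m → L2 ((Fin P.r → Fin d) × α)}
    {θ : Param m} (hφ : DifferentiableAt ℝ φ θ) (j : Fin m) :
    ‖partials (fun η => P.control k (φ η)) θ j‖ = ‖partials φ θ j‖ := by
  let L : L2 ((Fin P.r → Fin d) × α) →L[ℝ] L2 ((Fin P.r → Fin d) × α) :=
    (P.control k).toContinuousLinearEquiv.toContinuousLinearMap.restrictScalars ℝ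
  have h : partials (fun η => P.control k (φ η)) θ j = P.control k (partials φ θ j) :=
    congrArg (fun A => A (EuclideanSpace.single j (1 : ℝ)))
      (L.hasFDerivAt.comp θ hφ.hasFDerivAt).fderiv
  rw [h, LinearIsometryEquiv.norm_map]

theorem sqrt_sum_partials_drive_le (hS : S.IsSpherical) {t : ℝ} (ht : 0 ≤ t)
    {φ : Param m → L2 ((Fin P.r → Fin d) × α)} {θ : Param m}
    (hφ : DifferentiableAt ℝ φ θ) (n : ‖φ θ‖ = 1) :
    Real.sqrt (∑ j, ‖partials (fun η => P.drive S η t (φ η)) θ j‖ ^ 2) ≤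
      P.r * t * Real.sqrt (m / d) + Real.sqrt (∑ j, ‖partials φ θ j‖ ^ 2) := by
  refine (sqrt_sum_partials_ampliate_le
    ((contDiff_tensorPowerMatrix P.r (S.contDiff_channel t)).differentiable one_ne_zero θ) hφ
    (P.driveMatrix_mem_unitary S θ t) n).trans ?_
  gcongr
  refine (norm_stack_partials_tensorPowerMatrix_le P.r (S.contDiff_channel t)
    (S.channel_mem_unitary θ t)).trans ?_
  rw [mul_assoc]
  gcongr
  refine (S.norm_stack_partials_channel_le θ ht).trans ?_
  gcongr
  exact S.norm_stack_X_le hS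

/-- By the triangle inequality over the segments of the evolution; the controls are isometric and
do not depend on the parameter. -/
theorem sqrt_sum_partials_stateAt_le (hS : S.IsSpherical) (θ : Param m) (k : ℕ) :
    Real.sqrt (∑ j, ‖partials (fun η => P.stateAt S η k) θ j‖ ^ 2) ≤
      P.r * (∑ i ∈ Finset.range (k + 1), P.time i) * Real.sqrt (m / d) := by
  induction k with
  | zero =>
    have h := P.sqrt_sum_partials_drive_le S hS (P.time_nonneg 0) (θ := θ)
      (differentiableAt_const P.init) P.norm_init
    have h0 : (fun η => P.stateAt S η 0) = fun η => P.drive S η (P.time 0) P.init := rfl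
    rw [h0]
    simpa [partials] using h
  | succ k ih =>
    have h := P.sqrt_sum_partials_drive_le S hS (P.time_nonneg (k + 1))
      ((P.contDiff_control_comp k (P.contDiff_stateAt S k)).differentiable one_ne_zero θ)
      (by rw [LinearIsometryEquiv.norm_map, norm_stateAt])
    simp only [P.partials_control_comp k
      ((P.contDiff_stateAt S k).differentiable one_ne_zero θ)] at h
    rw [Finset.sum_range_succ]
    refine h.trans ?_
    linarith

theorem sum_norm_partials_probe_sq_le (hS : S.IsSpherical) (θ : Param m) :
    ∑ j, ‖partials (P.probe S) θ j‖ ^ 2 ≤ (P.r * P.evolutionTime) ^ 2 * (m / d) := by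
  have h := (Real.sqrt_le_left (by
    have : 0 ≤ P.evolutionTime := Finset.sum_nonneg fun i _ => P.time_nonneg i
    positivity)).1 (P.sqrt_sum_partials_stateAt_le S hS θ P.n)
  rw [mul_pow, Real.sq_sqrt (by positivity)] at h
  exact h

end Procedure

end Probe

/-! ### Copies of a state -/

section Copies

variable {ι : Type*} {N : ℕ}

theorem memlp_tensorCons (φ : L2 ι) (Ψ : L2 (Fin N → ι)) :
    Memℓp (fun f : Fin (N + 1) → ι => φ (f 0) * Ψ (Fin.tail f)) 2 := by
  have h0 : (0 : ℝ) < (2 : ENNReal).toReal := by norm_num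
  have h1 := (hasSum_norm_sq φ).summable.mul_of_nonneg (hasSum_norm_sq Ψ).summable
    (fun _ => sq_nonneg _) (fun _ => sq_nonneg _)
  refine (memℓp_gen_iff h0).2 (((splitFirst ι N).summable_iff.2 h1).congr fun f => ?_)
  simp [splitFirst, mul_pow]

/-- `φ ⊗ Ψ`, for one copy in the state `φ` and `N` further copies in the state `Ψ`. -/
def tensorCons (φ : L2 ι) (Ψ : L2 (Fin N → ι)) : L2 (Fin (N + 1) → ι) :=
  ⟨fun f => φ (f 0) * Ψ (Fin.tail f), memlp_tensorCons φ Ψ⟩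

theorem tensorCons_apply (φ : L2 ι) (Ψ : L2 (Fin N → ι)) (f : Fin (N + 1) → ι) :
    tensorCons φ Ψ f = φ (f 0) * Ψ (Fin.tail f) := rfl

theorem inner_tensorCons (φ φ' : L2 ι) (Ψ Ψ' : L2 (Fin N → ι)) :
    inner ℂ (tensorCons φ Ψ) (tensorCons φ' Ψ') = inner ℂ φ φ' * inner ℂ Ψ Ψ' := by
  have h1 := lp.hasSum_inner (𝕜 := ℂ) φ φ'
  have h2 := lp.hasSum_inner (𝕜 := ℂ) Ψ Ψ'
  have h3 := summable_mul_of_summable_norm h1.summable.norm h2.summable.norm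
  have h4 := (splitFirst ι N).hasSum_iff.2 (h1.mul h2 h3)
  have h5 : (fun f => inner ℂ (tensorCons φ Ψ f) (tensorCons φ' Ψ' f)) =
      (fun p : ι × (Fin N → ι) => inner ℂ (φ p.1) (φ' p.1) * inner ℂ (Ψ p.2) (Ψ' p.2)) ∘
        splitFirst ι N := by
    funext f
    simp [splitFirst, tensorCons_apply]
    ring
  refine (lp.hasSum_inner (𝕜 := ℂ) (tensorCons φ Ψ) (tensorCons φ' Ψ')).unique ?_
  rw [h5]
  exact h4

theorem norm_tensorCons (φ : L2 ι) (Ψ : L2 (Fin N → ι)) :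
    ‖tensorCons φ Ψ‖ = ‖φ‖ * ‖Ψ‖ := by
  refine (sq_eq_sq₀ (norm_nonneg _) (by positivity)).1 ?_
  have h := inner_tensorCons φ φ Ψ Ψ
  simp only [inner_self_eq_norm_sq_to_K] at h
  rw [mul_pow]
  exact_mod_cast h

/-- `(φ, Ψ) ↦ φ ⊗ Ψ` as a continuous bilinear map. -/
def tensorConsL (ι : Type*) (N : ℕ) : L2 ι →L[ℝ] L2 (Fin N → ι) →L[ℝ] L2 (Fin (N + 1) → ι) :=
  LinearMap.mkContinuous₂
    (LinearMap.mk₂ ℝ tensorCons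
      (fun φ φ' Ψ => by ext f; simp [tensorCons_apply, add_mul])
      (fun c φ Ψ => by ext f; simp [tensorCons_apply, mul_assoc])
      (fun φ Ψ Ψ' => by ext f; simp [tensorCons_apply, mul_add])
      (fun c φ Ψ => by ext f; simp [tensorCons_apply, mul_left_comm]))
    1 fun φ Ψ => by simpa using (norm_tensorCons φ Ψ).le

theorem tensorConsL_apply (φ : L2 ι) (Ψ : L2 (Fin N → ι)) :
    tensorConsL ι N φ Ψ = tensorCons φ Ψ := rfl

theorem tensorPower_succ (N : ℕ) (ψ : L2 ι) :
    tensorPower (N + 1) ψ = tensorCons ψ (tensorPower N ψ) := by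
  ext f
  exact Fin.prod_univ_succ _

theorem norm_tensorPower {ψ : L2 ι} (h : ‖ψ‖ = 1) (N : ℕ) : ‖tensorPower N ψ‖ = 1 := by
  induction N with
  | zero =>
    refine (sq_eq_sq₀ (norm_nonneg _) zero_le_one).1 ?_
    refine (hasSum_norm_sq (tensorPower 0 ψ)).unique ?_
    have h0 : (fun f : Fin 0 → ι => ‖tensorPower 0 ψ f‖ ^ 2) = fun _ => 1 := by
      funext f
      simp [tensorPower]
    rw [h0]
    simp
  | succ N ih => rw [tensorPower_succ, norm_tensorCons, h, ih, one_mul]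

variable {m : ℕ} {q : Param m → L2 ι}

theorem contDiff_tensorPower (hq : ContDiff ℝ 1 q) (N : ℕ) :
    ContDiff ℝ 1 fun θ => tensorPower N (q θ) := by
  induction N with
  | zero =>
    have h0 : (fun θ => tensorPower 0 (q θ)) = fun _ => tensorPower 0 (q 0) := by
      funext θ
      ext f
      simp [tensorPower]
    rw [h0]
    exact contDiff_const
  | succ N ih =>
    simp only [tensorPower_succ]
    exact ((tensorConsL ι N).contDiff.comp hq).clm_apply ih

/-- The component of the derivative orthogonal to the state itself. It is the part of the
derivative that changes the state other than by a phase. -/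
def horizontal (ψ φ : L2 ι) : L2 ι := φ - inner ℂ ψ φ • ψ

theorem inner_horizontal {ψ : L2 ι} (h : ‖ψ‖ = 1) (φ : L2 ι) :
    inner ℂ ψ (horizontal ψ φ) = 0 := by
  rw [horizontal, inner_sub_right, inner_smul_right, inner_self_eq_norm_sq_to_K, h]
  simp

theorem norm_horizontal_sq_le {ψ : L2 ι} (h : ‖ψ‖ = 1) (φ : L2 ι) :
    ‖horizontal ψ φ‖ ^ 2 ≤ ‖φ‖ ^ 2 := by
  have h1 : φ = horizontal ψ φ + inner ℂ ψ φ • ψ := by simp [horizontal]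
  have h2 := norm_add_sq_eq_norm_sq_add_norm_sq_of_inner_eq_zero (horizontal ψ φ)
    (inner ℂ ψ φ • ψ) (𝕜 := ℂ) (by
      rw [inner_smul_right, ← inner_conj_symm (horizontal ψ φ), inner_horizontal h]; simp)
  rw [← h1] at h2
  nlinarith [norm_nonneg (inner ℂ ψ φ • ψ)]

theorem partials_tensorPower_succ (hq : ContDiff ℝ 1 q) (N : ℕ) (θ : Param m) (j : Fin m) :
    partials (fun η => tensorPower (N + 1) (q η)) θ j =
      tensorCons (partials q θ j) (tensorPower N (q θ)) +
        tensorCons (q θ) (partials (fun η => tensorPower N (q η)) θ j) := by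
  simp only [tensorPower_succ]
  have h := (tensorConsL ι N).hasFDerivAt_of_bilinear
    (hq.differentiable one_ne_zero θ).hasFDerivAt
    ((contDiff_tensorPower hq N).differentiable one_ne_zero θ).hasFDerivAt
  refine (congrArg (fun L => L (EuclideanSpace.single j (1 : ℝ))) h.fderiv).trans ?_
  simp [partials, tensorConsL_apply, add_comm]

theorem horizontal_partials_tensorPower_succ (hq : ContDiff ℝ 1 q) {θ : Param m}
    (h : ‖q θ‖ = 1) (N : ℕ) (j : Fin m) :
    horizontal (tensorPower (N + 1) (q θ)) (partials (fun η => tensorPower (N + 1) (q η)) θ j) =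
      tensorCons (horizontal (q θ) (partials q θ j)) (tensorPower N (q θ)) +
        tensorCons (q θ) (horizontal (tensorPower N (q θ))
          (partials (fun η => tensorPower N (q η)) θ j)) := by
  rw [partials_tensorPower_succ hq, tensorPower_succ]
  unfold horizontal
  rw [inner_add_right, inner_tensorCons, inner_tensorCons, inner_self_eq_norm_sq_to_K,
    inner_self_eq_norm_sq_to_K, h, norm_tensorPower h]
  ext f
  simp only [lp.coeFn_add, lp.coeFn_sub, lp.coeFn_smul, Pi.add_apply, Pi.sub_apply, Pi.smul_apply,
    tensorCons_apply, smul_eq_mul]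
  push_cast
  ring

/-- The copies contribute additively: the summands of the horizontal derivative that differentiate
different copies are orthogonal to each other. -/
theorem norm_horizontal_partials_tensorPower_sq (hq : ContDiff ℝ 1 q) {θ : Param m}
    (h : ‖q θ‖ = 1) (N : ℕ) (j : Fin m) :
    ‖horizontal (tensorPower N (q θ)) (partials (fun η => tensorPower N (q η)) θ j)‖ ^ 2 =
      N * ‖horizontal (q θ) (partials q θ j)‖ ^ 2 := by
  induction N with
  | zero =>
    have h0 : (fun θ => tensorPower 0 (q θ)) = fun _ => tensorPower 0 (q 0) := by
      funext θ
      ext f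
      simp [tensorPower]
    simp [h0, partials, horizontal]
  | succ N ih =>
    rw [horizontal_partials_tensorPower_succ hq h]
    have h2 := norm_add_sq_eq_norm_sq_add_norm_sq_of_inner_eq_zero (𝕜 := ℂ)
      (tensorCons (horizontal (q θ) (partials q θ j)) (tensorPower N (q θ)))
      (tensorCons (q θ) (horizontal (tensorPower N (q θ))
          (partials (fun η => tensorPower N (q η)) θ j)))
      (by rw [inner_tensorCons, inner_horizontal (norm_tensorPower h N), mul_zero])
    rw [sq, h2, norm_tensorCons, norm_tensorCons, h, norm_tensorPower h, mul_one, one_mul,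
      ← sq, ← sq, ih]
    push_cast
    ring

theorem sum_norm_horizontal_tensorPower_sq_le (hq : ContDiff ℝ 1 q) {θ : Param m}
    (h : ‖q θ‖ = 1) (N : ℕ) :
    ∑ j, ‖horizontal (tensorPower N (q θ)) (partials (fun η => tensorPower N (q η)) θ j)‖ ^ 2 ≤
      N * ∑ j, ‖partials q θ j‖ ^ 2 := by
  rw [Finset.mul_sum]
  refine Finset.sum_le_sum fun j _ => ?_
  rw [norm_horizontal_partials_tensorPower_sq hq h]
  exact mul_le_mul_of_nonneg_left (norm_horizontal_sq_le h _) (Nat.cast_nonneg N)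

/-- The derivative of a curve of unit vectors has no real component along the curve. -/
theorem re_inner_partials_eq_zero {q : Param m → L2 ι} {θ : Param m}
    (hq : DifferentiableAt ℝ q θ) (h : ∀ η, ‖q η‖ = 1) (j : Fin m) :
    (inner ℂ (q θ) (partials q θ j)).re = 0 := by
  have h1 := (hq.hasFDerivAt.inner ℂ hq.hasFDerivAt)
  have h2 : (fun η => inner ℂ (q η) (q η)) = fun _ => (1 : ℂ) := by
    funext η
    rw [inner_self_eq_norm_sq_to_K, h η]
    simp
  rw [h2] at h1
  have h3 := congrArg (fun L => L (EuclideanSpace.single j (1 : ℝ)))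
    (h1.unique (hasFDerivAt_const _ _))
  have h4 := congrArg Complex.re h3
  simp [fderivInnerCLM_apply] at h4
  have h5 := inner_re_symm (𝕜 := ℂ) (q θ) (partials q θ j)
  simp only [partials, RCLike.re_eq_complex_re] at h5 ⊢
  linarith

end Copies

open MeasureTheory

/-! ### Observables of a quantum measurement -/

/-- An inequality between finite measures passes to integrals of bounded functions. The
coefficients may depend on the value of the function, as is seen on its level sets. -/
theorem sum_integral_comp_nonneg {Ω I : Type*} [MeasurableSpace Ω] [Fintype I]
    (μ : I → Measure Ω) [∀ i, IsFiniteMeasure (μ i)] (F : I → ℝ → ℝ) (hF : ∀ i, Continuous (F i))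
    (h : ∀ c s, MeasurableSet s → 0 ≤ ∑ i, F i c * (μ i).real s)
    {f : Ω → ℝ} (hf : Measurable f) {C : ℝ} (hC : ∀ ω, |f ω| ≤ C) :
    0 ≤ ∑ i, ∫ ω, F i (f ω) ∂μ i := by
  have hs := hf.stronglyMeasurable
  by_cases hC0 : 0 ≤ C
  swap
  -- A negative bound is possible only if there are no outcomes.
  · have : IsEmpty Ω := ⟨fun ω => hC0 ((abs_nonneg _).trans (hC ω))⟩
    simp [Measure.eq_zero_of_isEmpty]
  have key : ∀ n, 0 ≤ ∑ i, ∫ ω, F i (hs.approxBounded C n ω) ∂μ i := by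
    intro n
    set g := hs.approxBounded C n
    have hg : ∀ i, ∫ ω, F i (g ω) ∂μ i = ∑ c ∈ g.range, F i c * (μ i).real (g ⁻¹' {c}) := by
      intro i
      have h1 : (fun ω => F i (g ω)) =
          fun ω => ∑ c ∈ g.range, (g ⁻¹' {c}).indicator (fun _ => F i c) ω := by
        funext ω
        rw [Finset.sum_eq_single_of_mem (g ω) (g.mem_range_self ω)]
        · simp
        · intro c _ hc
          exact Set.indicator_of_notMem (fun h => hc (by simpa using h.symm)) _
      rw [h1, integral_finsetSum _ fun c _ =>
        (integrable_const _).indicator (g.measurableSet_fiber c)]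
      refine Finset.sum_congr rfl fun c _ => ?_
      rw [integral_indicator_const _ (g.measurableSet_fiber c), smul_eq_mul, mul_comm]
    simp only [hg]
    rw [Finset.sum_comm]
    exact Finset.sum_nonneg fun c _ => h c _ (g.measurableSet_fiber c)
  refine ge_of_tendsto' (x := Filter.atTop) (tendsto_finsetSum _ fun i _ => ?_) key
  obtain ⟨D, hD⟩ := (isCompact_Icc (a := -C) (b := C)).exists_bound_of_continuousOn
    (hF i).continuousOn
  refine tendsto_integral_of_dominated_convergence (fun _ => D) (fun n => ?_)
    (integrable_const D) (fun n => ?_) ?_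
  · exact ((hF i).measurable.comp (hs.approxBounded C n).measurable).aestronglyMeasurable
  · refine Filter.Eventually.of_forall fun ω => hD _ ?_
    exact abs_le.1 (hs.norm_approxBounded_le hC0 n ω)
  · refine Filter.Eventually.of_forall fun ω => ?_
    exact ((hF i).tendsto _).comp (hs.tendsto_approxBounded_of_norm_le (hC ω))

/-- A linear relation between finite measures passes to integrals of bounded functions. -/
theorem sum_mul_integral_eq_zero {Ω I : Type*} [MeasurableSpace Ω] [Fintype I]
    (μ : I → Measure Ω) [∀ i, IsFiniteMeasure (μ i)] (a : I → ℝ)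
    (h : ∀ s, MeasurableSet s → ∑ i, a i * (μ i).real s = 0)
    {f : Ω → ℝ} (hf : Measurable f) {C : ℝ} (hC : ∀ ω, |f ω| ≤ C) :
    ∑ i, a i * ∫ ω, f ω ∂μ i = 0 := by
  have h0 : ∀ c s, MeasurableSet s → ∑ i, a i * c * (μ i).real s = 0 := by
    intro c s hs
    rw [← mul_zero c, ← h s hs, Finset.mul_sum]
    exact Finset.sum_congr rfl fun i _ => by ring
  have h1 := sum_integral_comp_nonneg μ (fun i c => a i * c) (fun i => by fun_prop)
    (fun c s hs => (h0 c s hs).ge) hf hC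
  have h2 := sum_integral_comp_nonneg μ (fun i c => -(a i * c)) (fun i => by fun_prop)
    (fun c s hs => by simpa using (h0 c s hs).le) hf hC
  simp only [integral_neg, integral_const_mul, Finset.sum_neg_distrib] at h1 h2
  linarith

namespace POVM

variable {Ω : Type*} [MeasurableSpace Ω] {K : Type*} [NormedAddCommGroup K]
  [InnerProductSpace ℂ K] (M : POVM Ω K)

theorem law_univ (x : K) : M.law x Set.univ = ENNReal.ofReal (‖x‖ ^ 2) := by
  rw [M.law_apply x MeasurableSet.univ, M.total, one_apply_eq_self, inner_self_eq_norm_sq_to_K]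
  norm_cast

instance (x : K) : IsFiniteMeasure (M.law x) :=
  ⟨by rw [M.law_univ]; exact ENNReal.ofReal_lt_top⟩

theorem law_real (x : K) {s : Set Ω} (hs : MeasurableSet s) :
    (M.law x).real s = (inner ℂ x (M.effect s x)).re := by
  rw [Measure.real, M.law_apply x hs, ENNReal.toReal_ofReal (M.re_nonneg hs x)]

theorem law_real_univ (x : K) : (M.law x).real Set.univ = ‖x‖ ^ 2 := by
  rw [Measure.real, M.law_univ, ENNReal.toReal_ofReal (by positivity)]

theorem law_smul_eq {z w : ℂ} (h : ‖z‖ = ‖w‖) (x : K) : M.law (z • x) = M.law (w • x) := by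
  refine Measure.ext fun s hs => ?_
  have key : ∀ z : ℂ, inner ℂ (z • x) (M.effect s (z • x)) =
      ((‖z‖ ^ 2 : ℝ) : ℂ) * inner ℂ x (M.effect s x) := by
    intro z
    rw [map_smul, inner_smul_left, inner_smul_right, ← mul_assoc, Complex.conj_mul']
    push_cast
    rfl
  rw [M.law_apply _ hs, M.law_apply _ hs, key, key, h]

theorem re_inner_effect_comm {s : Set Ω} (hs : MeasurableSet s) (x y : K) :
    (inner ℂ x (M.effect s y)).re = (inner ℂ y (M.effect s x)).re := by
  have h : inner ℂ (M.effect s x) y = inner ℂ x (M.effect s y) := (M.pos s hs).isSymmetric x y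
  rw [← h]
  exact inner_re_symm (𝕜 := ℂ) _ _

theorem law_real_add (x y : K) {s : Set Ω} (hs : MeasurableSet s) :
    (M.law (x + y)).real s =
      (M.law x).real s + 2 * (inner ℂ x (M.effect s y)).re + (M.law y).real s := by
  rw [M.law_real _ hs, M.law_real _ hs, M.law_real _ hs]
  simp only [map_add, inner_add_left, inner_add_right, Complex.add_re]
  rw [M.re_inner_effect_comm hs y x]
  ring

theorem law_real_sub (x y : K) {s : Set Ω} (hs : MeasurableSet s) :
    (M.law (x - y)).real s =
      (M.law x).real s - 2 * (inner ℂ x (M.effect s y)).re + (M.law y).real s := by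
  rw [M.law_real _ hs, M.law_real _ hs, M.law_real _ hs]
  simp only [map_sub, inner_sub_left, inner_sub_right, Complex.sub_re]
  rw [M.re_inner_effect_comm hs y x]
  ring

/-- The real part of `⟨x, M(f) y⟩`, where `M(f) = ∫ f dM` is the observable with the values `f`.
It is obtained from the laws of the outcome by polarization, which avoids operator-valued
integrals. -/
def form (f : Ω → ℝ) (x y : K) : ℝ :=
  (∫ ω, f ω ∂M.law (x + y) - ∫ ω, f ω ∂M.law (x - y)) / 4

theorem form_comm (f : Ω → ℝ) (x y : K) : M.form f x y = M.form f y x := by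
  have h : M.law (x - y) = M.law (y - x) := by
    have := M.law_smul_eq (z := -1) (w := 1) (by simp) (y - x)
    simpa using this
  rw [form, form, h, add_comm x y]


theorem sum_mul_integral_law_eq_zero {I : Type*} [Fintype I] (x : I → K) (a : I → ℝ)
    (h : ∀ s, MeasurableSet s → ∑ i, a i * (M.law (x i)).real s = 0)
    {f : Ω → ℝ} (hf : Measurable f) {C : ℝ} (hC : ∀ ω, |f ω| ≤ C) :
    ∑ i, a i * ∫ ω, f ω ∂M.law (x i) = 0 :=
  sum_mul_integral_eq_zero (fun i => M.law (x i)) a h hf hC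

theorem form_add_left {f : Ω → ℝ} (hf : Measurable f) {C : ℝ} (hC : ∀ ω, |f ω| ≤ C)
    (x x' y : K) : M.form f (x + x') y = M.form f x y + M.form f x' y := by
  have h := M.sum_mul_integral_law_eq_zero
    ![x + x' + y, x + x' - y, x + y, x - y, x' + y, x' - y] ![1, -1, -1, 1, -1, 1] (by
      intro s hs
      simp only [Fin.sum_univ_six, Matrix.cons_val, M.law_real_add _ _ hs, M.law_real_sub _ _ hs,
        inner_add_left, Complex.add_re]
      ring) hf hC
  simp only [Fin.sum_univ_six, Matrix.cons_val] at h
  unfold form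
  linarith

theorem form_smul_left {f : Ω → ℝ} (hf : Measurable f) {C : ℝ} (hC : ∀ ω, |f ω| ≤ C)
    (c : ℝ) (x y : K) : M.form f (c • x) y = c * M.form f x y := by
  have h := M.sum_mul_integral_law_eq_zero
    ![c • x + y, c • x - y, x + y, x - y] ![1, -1, -c, c] (by
      intro s hs
      simp only [Fin.sum_univ_four, Matrix.cons_val, M.law_real_add _ _ hs, M.law_real_sub _ _ hs]
      rw [← Complex.coe_smul, inner_smul_left]
      simp only [Complex.conj_ofReal, Complex.re_ofReal_mul]
      ring) hf hC
  simp only [Fin.sum_univ_four, Matrix.cons_val] at h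
  unfold form
  linarith

theorem form_self {f : Ω → ℝ} (hf : Measurable f) {C : ℝ} (hC : ∀ ω, |f ω| ≤ C)
    (x : K) : M.form f x x = ∫ ω, f ω ∂M.law x := by
  have h := M.sum_mul_integral_law_eq_zero ![x + x, x - x, x] ![1, -1, -4] (by
      intro s hs
      simp only [Fin.sum_univ_three, Matrix.cons_val, M.law_real_add _ _ hs,
        M.law_real_sub _ _ hs]
      rw [M.law_real x hs]
      ring) hf hC
  simp only [Fin.sum_univ_three, Matrix.cons_val] at h
  unfold form
  linarith

theorem form_sub_const {f : Ω → ℝ} (hf : Measurable f) {C : ℝ} (hC : ∀ ω, |f ω| ≤ C) (c : ℝ)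
    (x y : K) : M.form (fun ω => f ω - c) x y = M.form f x y - c * (inner ℂ x y).re := by
  have hi : ∀ z, Integrable f (M.law z) := fun z =>
    (integrable_const C).mono' hf.aestronglyMeasurable (Filter.Eventually.of_forall hC)
  have h1 := M.law_real_add x y MeasurableSet.univ
  have h2 := M.law_real_sub x y MeasurableSet.univ
  rw [M.total, one_apply_eq_self] at h1 h2
  unfold form
  rw [integral_sub (hi _) (integrable_const c), integral_sub (hi _) (integrable_const c),
    integral_const, integral_const, h1, h2]
  simp only [smul_eq_mul]
  ring

/-- Moving along the phase of a state does not change the outcome of a measurement. -/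
theorem form_I_smul_self (f : Ω → ℝ) (a : ℝ) (x : K) :
    M.form f ((Complex.I * a) • x) x = 0 := by
  have h : M.law ((Complex.I * a) • x + x) = M.law ((Complex.I * a) • x - x) := by
    have h1 : (Complex.I * a) • x + x = (Complex.I * a + 1) • x := by rw [add_smul, one_smul]
    have h2 : (Complex.I * a) • x - x = (Complex.I * a - 1) • x := by rw [sub_smul, one_smul]
    rw [h1, h2]
    refine M.law_smul_eq ?_ x
    refine (sq_eq_sq₀ (norm_nonneg _) (norm_nonneg _)).1 ?_
    simp [Complex.sq_norm, Complex.normSq_apply]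
  rw [form, h, sub_self, zero_div]

/-- `2 Re⟨x, M(f) y⟩ ≤ ‖x‖² + ⟨y, M(f²) y⟩`. On an event where `f` takes the value `c`, this is the
positivity of the law of the outcome in the state `x - c y`. -/
theorem two_mul_form_le {f : Ω → ℝ} (hf : Measurable f) {C : ℝ} (hC : ∀ ω, |f ω| ≤ C)
    (x y : K) : 2 * M.form f x y ≤ ‖x‖ ^ 2 + ∫ ω, f ω ^ 2 ∂M.law y := by
  have h := sum_integral_comp_nonneg (fun i => M.law (![x, x + y, x - y, y] i))
    ![fun _ => 1, fun c => -(1 / 2) * c, fun c => 1 / 2 * c, fun c => c ^ 2]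
    (by
      intro i
      fin_cases i <;> simp only [Fin.reduceFinMk, Matrix.cons_val] <;> fun_prop)
    (by
      intro c s hs
      have h0 : 0 ≤ (M.law (x - c • y)).real s := measureReal_nonneg
      rw [M.law_real_sub _ _ hs, M.law_real (c • y) hs, ← Complex.coe_smul, map_smul,
        inner_smul_right, inner_smul_left, inner_smul_right] at h0
      simp only [Complex.conj_ofReal, Complex.re_ofReal_mul] at h0
      simp only [Fin.sum_univ_four, Matrix.cons_val, M.law_real_add _ _ hs,
        M.law_real_sub _ _ hs]
      rw [M.law_real y hs]
      linarith) hf hC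
  simp only [Fin.sum_univ_four, Matrix.cons_val, integral_const, smul_eq_mul, mul_one,
    integral_const_mul] at h
  rw [M.law_real_univ] at h
  unfold form
  linarith

/-- The Cauchy-Schwarz inequality for the observable `M(f)`, combined with `M(f)² ≤ M(f²)`. -/
theorem form_sq_le {f : Ω → ℝ} (hf : Measurable f) {C : ℝ} (hC : ∀ ω, |f ω| ≤ C)
    (x y : K) : M.form f x y ^ 2 ≤ ‖x‖ ^ 2 * ∫ ω, f ω ^ 2 ∂M.law y := by
  -- The previous inequality for all multiples of `x` is a quadratic inequality.
  have h := discrim_le_zero (a := ‖x‖ ^ 2) (b := -(2 * M.form f x y))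
    (c := ∫ ω, f ω ^ 2 ∂M.law y) fun t => by
      have h1 := M.two_mul_form_le hf hC (t • x) y
      rw [M.form_smul_left hf hC, norm_smul, mul_pow, Real.norm_eq_abs, sq_abs] at h1
      linarith
  unfold discrim at h
  linarith

theorem abs_form_le {f : Ω → ℝ} (hf : Measurable f) {C : ℝ} (hC : ∀ ω, |f ω| ≤ C)
    (x y : K) : |M.form f x y| ≤ |C| * ‖x‖ * ‖y‖ := by
  refine abs_le_of_sq_le_sq ?_ (by positivity)
  refine (M.form_sq_le hf hC x y).trans ?_
  have h1 : ∫ ω, f ω ^ 2 ∂M.law y ≤ ∫ _, C ^ 2 ∂M.law y := by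
    refine integral_mono_of_nonneg (Filter.Eventually.of_forall fun ω => sq_nonneg _)
      (integrable_const _) (Filter.Eventually.of_forall fun ω => ?_)
    exact sq_le_sq.2 ((hC ω).trans (le_abs_self C))
  rw [integral_const, M.law_real_univ, smul_eq_mul] at h1
  rw [mul_pow, mul_pow, sq_abs]
  nlinarith [sq_nonneg ‖x‖]

/-- `Re⟨x, M(f) y⟩` as a continuous real bilinear form. -/
def formL {f : Ω → ℝ} (hf : Measurable f) {C : ℝ} (hC : ∀ ω, |f ω| ≤ C) : K →L[ℝ] K →L[ℝ] ℝ :=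
  LinearMap.mkContinuous₂
    (LinearMap.mk₂ ℝ (M.form f) (M.form_add_left hf hC) (M.form_smul_left hf hC)
      (fun x y y' => by
        rw [M.form_comm, M.form_add_left hf hC, M.form_comm _ y, M.form_comm _ y'])
      (fun c x y => by rw [M.form_comm, M.form_smul_left hf hC, M.form_comm _ y]; rfl))
    |C| fun x y => M.abs_form_le hf hC x y

variable {m : ℕ} {ψ : Param m → K}

theorem contDiff_integral_law (hψ : ContDiff ℝ 1 ψ) {f : Ω → ℝ} (hf : Measurable f) {C : ℝ}
    (hC : ∀ ω, |f ω| ≤ C) : ContDiff ℝ 1 fun θ => ∫ ω, f ω ∂M.law (ψ θ) := by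
  simp only [← M.form_self hf hC]
  exact ((M.formL hf hC).contDiff.comp hψ).clm_apply hψ

theorem partials_integral_law {θ : Param m} (hψ : DifferentiableAt ℝ ψ θ) {f : Ω → ℝ}
    (hf : Measurable f) {C : ℝ} (hC : ∀ ω, |f ω| ≤ C) (j : Fin m) :
    partials (fun η => ∫ ω, f ω ∂M.law (ψ η)) θ j = 2 * M.form f (partials ψ θ j) (ψ θ) := by
  simp only [← M.form_self hf hC]
  have h := (M.formL hf hC).hasFDerivAt_of_bilinear hψ.hasFDerivAt hψ.hasFDerivAt
  refine (congrArg (fun L => L (EuclideanSpace.single j (1 : ℝ))) h.fderiv).trans ?_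
  change M.form f (ψ θ) (partials ψ θ j) + M.form f (partials ψ θ j) (ψ θ) = _
  rw [M.form_comm f (ψ θ)]
  ring

end POVM

/-- The information inequality for one observable: the derivative of its expectation, at a unit
vector whose derivative has no real component along it, is at most `2 ‖h‖` times its standard
deviation, where `h` is the horizontal component of the derivative. -/
theorem POVM.partials_integral_law_le {ι Ω : Type*} [MeasurableSpace Ω] (M : POVM Ω (L2 ι))
    {m : ℕ} {ψ : Param m → L2 ι} {θ : Param m} (hψ : DifferentiableAt ℝ ψ θ)
    (h1 : ∀ η, ‖ψ η‖ = 1) {f : Ω → ℝ} (hf : Measurable f) {C : ℝ} (hC : ∀ ω, |f ω| ≤ C)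
    (c : ℝ) (j : Fin m) :
    partials (fun η => ∫ ω, f ω ∂M.law (ψ η)) θ j ≤
      2 * (‖horizontal (ψ θ) (partials ψ θ j)‖ *
        Real.sqrt (∫ ω, (f ω - c) ^ 2 ∂M.law (ψ θ))) := by
  have hr := re_inner_partials_eq_zero hψ h1 j
  have hg : Measurable fun ω => f ω - c := hf.sub_const c
  have hgC : ∀ ω, |f ω - c| ≤ C + |c| := fun ω => (abs_sub _ _).trans (by gcongr; exact hC ω)
  have e1 : M.form f (partials ψ θ j) (ψ θ) =
      M.form (fun ω => f ω - c) (partials ψ θ j) (ψ θ) := by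
    have := inner_re_symm (𝕜 := ℂ) (ψ θ) (partials ψ θ j)
    simp only [RCLike.re_eq_complex_re] at this
    rw [M.form_sub_const hf hC, ← this, hr, mul_zero, sub_zero]
  -- The inner product of the state with its derivative is imaginary, so the component removed
  -- by `horizontal` is a change of phase.
  have e2 : partials ψ θ j = horizontal (ψ θ) (partials ψ θ j) +
      (Complex.I * ((inner ℂ (ψ θ) (partials ψ θ j)).im : ℂ)) • ψ θ := by
    have h3 : Complex.I * ((inner ℂ (ψ θ) (partials ψ θ j)).im : ℂ) =
        inner ℂ (ψ θ) (partials ψ θ j) := by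
      apply Complex.ext <;> simp [hr]
    rw [h3, horizontal, sub_add_cancel]
  have e3 : M.form (fun ω => f ω - c) (partials ψ θ j) (ψ θ) =
      M.form (fun ω => f ω - c) (horizontal (ψ θ) (partials ψ θ j)) (ψ θ) := by
    conv_lhs => rw [e2]
    rw [M.form_add_left hg hgC, M.form_I_smul_self, add_zero]
  refine ((M.partials_integral_law hψ hf hC j).trans
    (congrArg (fun t => 2 * t) (e1.trans e3))).trans_le ?_
  gcongr
  refine (Real.le_sqrt_of_sq_le (M.form_sq_le hg hgC _ _)).trans ?_
  rw [Real.sqrt_mul (sq_nonneg _), Real.sqrt_sq (norm_nonneg _)]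

/-! ### The divergence of a bounded vector field -/

section Divergence

variable {m : ℕ}

/-- The divergence `∑_j ∂_j F_j` of a vector field. -/
def divergence (F : Param m → Param m) (x : Param m) : ℝ := ∑ j, partials F x j j

theorem fderiv_coord {F : Param m → Param m} {x : Param m} (hF : DifferentiableAt ℝ F x)
    (j : Fin m) (v : Param m) : fderiv ℝ (fun y => F y j) x v = fderiv ℝ F x v j :=
  congrArg (fun L => L v)
    ((EuclideanSpace.proj j : Param m →L[ℝ] ℝ).hasFDerivAt.comp x hF.hasFDerivAt).fderiv

theorem contDiff_coord {F : Param m → Param m} (hF : ContDiff ℝ 1 F) (j : Fin m) :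
    ContDiff ℝ 1 fun y => F y j :=
  (EuclideanSpace.proj j : Param m →L[ℝ] ℝ).contDiff.comp hF

theorem continuous_divergence {F : Param m → Param m} (hF : ContDiff ℝ 1 F) :
    Continuous (divergence F) := by
  refine continuous_finsetSum _ fun j _ => ?_
  exact (EuclideanSpace.proj j : Param m →L[ℝ] ℝ).continuous.comp
    ((hF.continuous_fderiv one_ne_zero).clm_apply continuous_const)

/-- Integration by parts against a test function. -/
theorem integral_mul_divergence {φ : Param m → ℝ} (hφ : ContDiff ℝ 1 φ)
    (hc : HasCompactSupport φ) {F : Param m → Param m} (hF : ContDiff ℝ 1 F) :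
    ∫ x, φ x * divergence F x = ∫ x, -fderiv ℝ φ x (F x) := by
  have hi1 : ∀ j : Fin m, Integrable fun x =>
      fderiv ℝ φ x (EuclideanSpace.single j 1) * F x j := fun j =>
    (((hφ.continuous_fderiv one_ne_zero).clm_apply continuous_const).mul
      (contDiff_coord hF j).continuous).integrable_of_hasCompactSupport
        (hc.fderiv_apply (𝕜 := ℝ) _).mul_right
  have hi2 : ∀ j : Fin m, Integrable fun x =>
      φ x * fderiv ℝ (fun y => F y j) x (EuclideanSpace.single j 1) := fun j =>
    (hφ.continuous.mul (((contDiff_coord hF j).continuous_fderiv one_ne_zero).clm_apply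
      continuous_const)).integrable_of_hasCompactSupport hc.mul_right
  have hi3 : ∀ j : Fin m, Integrable fun x => φ x * F x j := fun j =>
    (hφ.continuous.mul (contDiff_coord hF j).continuous).integrable_of_hasCompactSupport
      hc.mul_right
  have hparts : ∀ j : Fin m, ∫ x, φ x * fderiv ℝ (fun y => F y j) x (EuclideanSpace.single j 1) =
      -∫ x, fderiv ℝ φ x (EuclideanSpace.single j 1) * F x j := fun j =>
    integral_mul_fderiv_eq_neg_fderiv_mul_of_integrable (hi1 j) (hi2 j) (hi3 j)
      (fun x _ => hφ.differentiable one_ne_zero x)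
      (fun x _ => (contDiff_coord hF j).differentiable one_ne_zero x)
  have e1 : ∀ x, φ x * divergence F x =
      ∑ j, φ x * fderiv ℝ (fun y => F y j) x (EuclideanSpace.single j 1) := by
    intro x
    rw [divergence, Finset.mul_sum]
    refine Finset.sum_congr rfl fun j _ => ?_
    rw [fderiv_coord (hF.differentiable one_ne_zero x)]
    rfl
  have e2 : ∀ x, fderiv ℝ φ x (F x) =
      ∑ j, fderiv ℝ φ x (EuclideanSpace.single j 1) * F x j := by
    intro x
    have hx : F x = ∑ j, F x j • EuclideanSpace.single j (1 : ℝ) := by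
      ext i
      simp [Finset.sum_apply, Pi.single_apply]
    conv_lhs => rw [hx]
    simp [map_sum, mul_comm]
  simp only [e1, e2]
  rw [integral_finsetSum _ fun j _ => hi2 j, integral_neg, integral_finsetSum _ fun j _ => hi1 j,
    ← Finset.sum_neg_distrib]
  exact Finset.sum_congr rfl fun j _ => hparts j

/-- A smooth function that is one on the ball of radius `ρ` and vanishes outside the ball of
radius `R`. -/
def radialCutoff (ρ R : ℝ) (x : Param m) : ℝ :=
  Real.smoothTransition ((R ^ 2 - ‖x‖ ^ 2) / (R ^ 2 - ρ ^ 2))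

theorem contDiff_radialCutoff (ρ R : ℝ) : ContDiff ℝ 1 (radialCutoff (m := m) ρ R) :=
  (Real.smoothTransition.contDiff (n := 1)).comp
    ((contDiff_const.sub (contDiff_norm_sq ℝ)).div_const _)

theorem radialCutoff_eq_zero {ρ R : ℝ} (hR : 0 < R) (h : ρ ^ 2 < R ^ 2) {x : Param m}
    (hx : R ≤ ‖x‖) : radialCutoff ρ R x = 0 := by
  refine Real.smoothTransition.zero_of_nonpos (div_nonpos_of_nonpos_of_nonneg ?_ ?_)
  · nlinarith
  · linarith

theorem hasCompactSupport_radialCutoff {ρ R : ℝ} (hR : 0 < R) (h : ρ ^ 2 < R ^ 2) :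
    HasCompactSupport (radialCutoff (m := m) ρ R) := by
  refine HasCompactSupport.intro (isCompact_closedBall 0 R) fun x hx => ?_
  refine radialCutoff_eq_zero hR h ?_
  simpa using (lt_of_not_ge fun hh => hx (by simpa using hh)).le

/-- The cutoff decreases in the radial direction, and it varies only for `ρ ≤ ‖x‖ ≤ R`. -/
theorem neg_fderiv_radialCutoff_nonneg {ρ R : ℝ} (hR : 0 < R) (h : ρ ^ 2 < R ^ 2)
    {x v : Param m} (hv : ρ ≤ ‖x‖ → ‖x‖ ≤ R → 0 ≤ inner ℝ x v) :
    0 ≤ -fderiv ℝ (radialCutoff ρ R) x v := by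
  set u : ℝ := (R ^ 2 - ‖x‖ ^ 2) / (R ^ 2 - ρ ^ 2) with hu
  have hden : 0 < R ^ 2 - ρ ^ 2 := by linarith
  have h1 : HasFDerivAt (fun y : Param m => (R ^ 2 - ‖y‖ ^ 2) / (R ^ 2 - ρ ^ 2))
      ((R ^ 2 - ρ ^ 2)⁻¹ • -((2 : ℕ) • (innerSL ℝ x : Param m →L[ℝ] ℝ)) : Param m →L[ℝ] ℝ) x := by
    have h2 := ((hasStrictFDerivAt_norm_sq x).hasFDerivAt.const_sub (R ^ 2)).const_smul
      (R ^ 2 - ρ ^ 2)⁻¹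
    refine h2.congr_of_eventuallyEq (Filter.Eventually.of_forall fun y => ?_)
    simp [div_eq_inv_mul]
  have h3 := ((Real.smoothTransition.contDiff (n := 1)).differentiable one_ne_zero
    u).hasDerivAt.comp_hasFDerivAt x h1
  have h4 : fderiv ℝ (radialCutoff ρ R) x v =
      deriv Real.smoothTransition u * ((R ^ 2 - ρ ^ 2)⁻¹ * -(2 * inner ℝ x v)) := by
    refine (congrArg (fun L => L v) h3.fderiv).trans ?_
    simp
  have h5 : 0 ≤ deriv Real.smoothTransition u := Real.smoothTransition.monotone.deriv_nonneg
  rw [h4]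
  by_cases hx : ρ ≤ ‖x‖ ∧ ‖x‖ ≤ R
  · have h6 := hv hx.1 hx.2
    have h7 : 0 ≤ (R ^ 2 - ρ ^ 2)⁻¹ := by positivity
    have h8 := mul_nonneg h5 (mul_nonneg h7 h6)
    linarith
  · have h9 : deriv Real.smoothTransition u = 0 := by
      rcases not_and_or.1 hx with h' | h'
      · have h10 : 1 < u := by
          rw [hu, one_lt_div hden]
          nlinarith [norm_nonneg x]
        have h11 : Real.smoothTransition =ᶠ[nhds u] fun _ => 1 := by
          filter_upwards [lt_mem_nhds h10] with t ht
          exact Real.smoothTransition.one_of_one_le ht.le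
        rw [h11.deriv_eq, deriv_const]
      · have h10 : u < 0 := by
          rw [hu]
          refine div_neg_of_neg_of_pos ?_ hden
          nlinarith [norm_nonneg x]
        have h11 : Real.smoothTransition =ᶠ[nhds u] fun _ => 0 := by
          filter_upwards [gt_mem_nhds h10] with t ht
          exact Real.smoothTransition.zero_of_nonpos ht.le
        rw [h11.deriv_eq, deriv_const]
    rw [h9]
    simp

theorem divergence_add_smul {b : Param m → Param m} {x : Param m} (hb : DifferentiableAt ℝ b x)
    (c : ℝ) : divergence (fun y => b y + c • y) x = divergence b x + c * m := by
  have h : ∀ j, partials (fun y => b y + c • y) x j = partials b x j +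
      c • EuclideanSpace.single j (1 : ℝ) := by
    intro j
    have h1 := hb.hasFDerivAt.add ((hasFDerivAt_id x).const_smul c)
    refine (congrArg (fun L => L (EuclideanSpace.single j (1 : ℝ))) h1.fderiv).trans ?_
    simp [partials]
  simp [divergence, h, Finset.sum_add_distrib, mul_comm]

/-- A vector field that is bounded by `β` on the ball of radius `R` has a divergence above `-c m`
somewhere in the ball, if `β < c R`. The average of the divergence over the ball is a flux through
the sphere, and at least `-β m / R`. Here a smooth cutoff takes the place of the indicator of the
ball, and the linear field `c x` that of the volume and the area. -/
theorem exists_divergence_gt (hm : 0 < m) {b : Param m → Param m} (hb : ContDiff ℝ 1 b)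
    {β c R : ℝ} (hR : 0 < R) (hβ : ∀ x, ‖x‖ ≤ R → ‖b x‖ ≤ β) (hc : β < c * R) :
    ∃ x, ‖x‖ ≤ R ∧ -(c * m) < divergence b x := by
  by_contra hcon
  push Not at hcon
  have hm' : (0 : ℝ) < m := by exact_mod_cast hm
  have hβ0 : 0 ≤ β := (norm_nonneg _).trans (hβ 0 (by simpa using hR.le))
  have hc0 : 0 < c := pos_of_mul_pos_left (hβ0.trans_lt hc) hR.le
  -- The margin between `c'` and `c` makes the divergence of `b + c' x` strictly negative, while
  -- `b + c' x` points outwards as soon as `‖x‖ ≥ β / c'`.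
  obtain ⟨c', hc1, hc2⟩ := exists_between ((div_lt_iff₀ hR).2 hc)
  have hc'0 : 0 < c' := (div_nonneg hβ0 hR.le).trans_lt hc1
  have hρ0 : 0 ≤ β / c' := div_nonneg hβ0 hc'0.le
  have hρR : β / c' < R := by
    rw [div_lt_iff₀ hR] at hc1
    rw [div_lt_iff₀ hc'0]
    linarith
  have hsq : (β / c') ^ 2 < R ^ 2 := pow_lt_pow_left₀ hρR hρ0 two_ne_zero
  set φ : Param m → ℝ := radialCutoff (β / c') R
  have hφ : ContDiff ℝ 1 φ := contDiff_radialCutoff _ _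
  have hφc : HasCompactSupport φ := hasCompactSupport_radialCutoff hR hsq
  have hφ0 : ∀ x, 0 ≤ φ x := fun x => Real.smoothTransition.nonneg _
  have hF : ContDiff ℝ 1 fun y => b y + c' • y := hb.add (contDiff_id.const_smul c')
  have h1 := integral_mul_divergence hφ hφc hF
  have h2 : 0 ≤ ∫ x, -fderiv ℝ φ x (b x + c' • x) := by
    refine integral_nonneg fun x => neg_fderiv_radialCutoff_nonneg hR hsq fun hx1 hx2 => ?_
    rw [inner_add_right, inner_smul_right, real_inner_self_eq_norm_sq]
    have h3 := neg_le_of_abs_le (abs_real_inner_le_norm x (b x))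
    rw [div_le_iff₀ hc'0] at hx1
    nlinarith [norm_nonneg x, hβ x hx2]
  have h3 : ∫ x, φ x * divergence (fun y => b y + c' • y) x ≤ ∫ x, φ x * -((c - c') * m) := by
    refine integral_mono
      ((hφ.continuous.mul (continuous_divergence hF)).integrable_of_hasCompactSupport hφc.mul_right)
      ((hφ.continuous.integrable_of_hasCompactSupport hφc).mul_const _) fun x => ?_
    rcases le_or_gt ‖x‖ R with hx | hx
    · refine mul_le_mul_of_nonneg_left ?_ (hφ0 x)
      rw [divergence_add_smul (hb.differentiable one_ne_zero x)]
      linarith [hcon x hx]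
    · have : φ x = 0 := radialCutoff_eq_zero hR hsq hx.le
      simp [this]
  have h4 : 0 < ∫ x, φ x := by
    refine hφ.continuous.integral_pos_of_hasCompactSupport_nonneg_nonzero hφc hφ0 (x := 0) ?_
    refine (Real.smoothTransition.pos_of_pos ?_).ne'
    rw [norm_zero]
    exact div_pos (by simpa using pow_pos hR 2) (by linarith)
  rw [integral_mul_const] at h3
  nlinarith [mul_pos h4 (mul_pos (sub_pos.2 hc2) hm')]

end Divergence

/-! ### The information inequality for estimation procedures -/

namespace Procedure

variable {d m : ℕ} {α : Type*} {Ω : Type*} [MeasurableSpace Ω] (P : Procedure d m α Ω)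
  (S : Model d m)

theorem norm_probe (θ : Param m) : ‖P.probe S θ‖ = 1 := P.norm_stateAt S θ P.n

theorem contDiff_probe : ContDiff ℝ 1 (P.probe S) := P.contDiff_stateAt S P.n

instance (θ : Param m) : IsProbabilityMeasure (P.law S θ) := by
  refine ⟨?_⟩
  rw [law, POVM.law_univ, norm_tensorPower (P.norm_probe S θ)]
  simp

theorem measurable_est_apply (j : Fin m) : Measurable fun ω => P.est ω j :=
  (EuclideanSpace.proj j : Param m →L[ℝ] ℝ).continuous.measurable.comp P.measurable_est

theorem evolutionTime_nonneg : 0 ≤ P.evolutionTime :=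
  Finset.sum_nonneg fun i _ => P.time_nonneg i

variable {P}

theorem BoundedEst.exists_abs_le (hP : P.BoundedEst) : ∃ C : ℝ, ∀ ω j, |P.est ω j| ≤ C :=
  let ⟨C, hC⟩ := hP
  ⟨C, fun ω j => (PiLp.norm_apply_le (P.est ω) j).trans (hC ω)⟩

theorem BoundedEst.mean_apply (hP : P.BoundedEst) (θ : Param m) (j : Fin m) :
    P.mean S θ j = ∫ ω, P.est ω j ∂P.law S θ := by
  obtain ⟨C, hC⟩ := hP
  have hi : Integrable P.est (P.law S θ) :=
    (integrable_const C).mono' P.measurable_est.aestronglyMeasurable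
      (Filter.Eventually.of_forall hC)
  exact ((EuclideanSpace.proj j : Param m →L[ℝ] ℝ).integral_comp_comm hi).symm

theorem BoundedEst.contDiff_mean (hP : P.BoundedEst) : ContDiff ℝ 1 (P.mean S) := by
  obtain ⟨C, hC⟩ := hP.exists_abs_le
  refine contDiff_euclidean.2 fun j => ?_
  simp only [hP.mean_apply S]
  exact P.meas.contDiff_integral_law (contDiff_tensorPower (P.contDiff_probe S) P.N)
    (P.measurable_est_apply j) fun ω => hC ω j

theorem BoundedEst.contDiff_bias (hP : P.BoundedEst) : ContDiff ℝ 1 (P.bias S) :=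
  (hP.contDiff_mean S).sub contDiff_id

variable (P)

theorem trace_cov (θ : Param m) : (P.cov S θ).trace =
    ∑ j, ∫ ω, (P.est ω j - P.mean S θ j) ^ 2 ∂P.law S θ := by
  simp only [Matrix.trace, Matrix.diag, cov, Matrix.of_apply, sq]

theorem trace_cov_nonneg (θ : Param m) : 0 ≤ (P.cov S θ).trace := by
  rw [trace_cov]
  exact Finset.sum_nonneg fun j _ => integral_nonneg fun ω => sq_nonneg _

theorem trace_one_add_biasDeriv (θ : Param m) :
    (1 + P.biasDeriv S θ).trace = m + divergence (P.bias S) θ := by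
  rw [Matrix.trace_add, Matrix.trace_one, Fintype.card_fin]
  rfl

variable {P}

theorem BoundedEst.divergence_mean (hP : P.BoundedEst) (θ : Param m) :
    divergence (P.mean S) θ = m + divergence (P.bias S) θ := by
  have h : P.mean S = fun η => P.bias S η + (1 : ℝ) • η := by
    funext η
    simp [bias]
  rw [h, divergence_add_smul ((hP.contDiff_bias S).differentiable one_ne_zero θ)]
  ring

/-- The information inequality in traced form. The Cauchy-Schwarz inequality over the `m`
coordinates replaces the inversion of the information matrix. -/
theorem BoundedEst.divergence_mean_le (hP : P.BoundedEst) (hS : S.IsSpherical) (θ : Param m) :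
    divergence (P.mean S) θ ≤
      2 * Real.sqrt (P.N * ((P.r * P.evolutionTime) ^ 2 * (m / d)) * (P.cov S θ).trace) := by
  obtain ⟨C, hC⟩ := hP.exists_abs_le
  set ψ : Param m → L2 (Fin P.N → (Fin P.r → Fin d) × α) := fun η => tensorPower P.N (P.probe S η)
    with hψ
  have hψd : DifferentiableAt ℝ ψ θ :=
    (contDiff_tensorPower (P.contDiff_probe S) P.N).differentiable one_ne_zero θ
  have hψn : ∀ η, ‖ψ η‖ = 1 := fun η => norm_tensorPower (P.norm_probe S η) _
  have h1 : ∀ j, partials (P.mean S) θ j j ≤ 2 * (‖horizontal (ψ θ) (partials ψ θ j)‖ *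
      Real.sqrt (∫ ω, (P.est ω j - P.mean S θ j) ^ 2 ∂P.law S θ)) := by
    intro j
    have h2 := P.meas.partials_integral_law_le hψd hψn (P.measurable_est_apply j)
      (fun ω => hC ω j) (P.mean S θ j) j
    have h3 : (fun η => ∫ ω, P.est ω j ∂P.meas.law (ψ η)) = fun η => P.mean S η j :=
      funext fun η => (hP.mean_apply S η j).symm
    rw [h3] at h2
    have h4 : partials (fun η => P.mean S η j) θ j = partials (P.mean S) θ j j :=
      fderiv_coord ((hP.contDiff_mean S).differentiable one_ne_zero θ) j _
    rw [h4] at h2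
    exact h2
  have hV : ∀ j, 0 ≤ ∫ ω, (P.est ω j - P.mean S θ j) ^ 2 ∂P.law S θ :=
    fun j => integral_nonneg fun ω => sq_nonneg _
  calc divergence (P.mean S) θ
      ≤ 2 * ∑ j, ‖horizontal (ψ θ) (partials ψ θ j)‖ *
          Real.sqrt (∫ ω, (P.est ω j - P.mean S θ j) ^ 2 ∂P.law S θ) := by
        rw [Finset.mul_sum]
        exact Finset.sum_le_sum fun j _ => h1 j
    _ ≤ 2 * (Real.sqrt (∑ j, ‖horizontal (ψ θ) (partials ψ θ j)‖ ^ 2) *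
          Real.sqrt (P.cov S θ).trace) := by
        refine mul_le_mul_of_nonneg_left ?_ zero_le_two
        refine (Real.sum_mul_le_sqrt_mul_sqrt _ _ _).trans_eq ?_
        simp only [Real.sq_sqrt (hV _), trace_cov]
    _ ≤ _ := by
        rw [← Real.sqrt_mul (Finset.sum_nonneg fun j _ => sq_nonneg _)]
        refine mul_le_mul_of_nonneg_left (Real.sqrt_le_sqrt ?_) zero_le_two
        refine mul_le_mul_of_nonneg_right ?_ (P.trace_cov_nonneg S θ)
        refine (sum_norm_horizontal_tensorPower_sq_le (P.contDiff_probe S)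
          (P.norm_probe S θ) P.N).trans ?_
        exact mul_le_mul_of_nonneg_left (P.sum_norm_partials_probe_sq_le S hS θ)
          (Nat.cast_nonneg _)

/-- The information inequality, solved for `m d`; `a` is the fraction of `Tr[I] = m` that the bias
leaves. -/
theorem BoundedEst.sq_mul_le_of_le_divergence (hP : P.BoundedEst) (hS : S.IsSpherical)
    {θ : Param m} {a : ℝ} (ha : 0 ≤ a) (h : a * m ≤ divergence (P.mean S) θ) :
    a ^ 2 * (m * d) ≤ 4 * P.N * (P.r * P.evolutionTime) ^ 2 * (P.cov S θ).trace := by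
  have hV := P.trace_cov_nonneg S θ
  have hR : 0 ≤ 4 * P.N * (P.r * P.evolutionTime) ^ 2 * (P.cov S θ).trace := by positivity
  rcases Nat.eq_zero_or_pos m with rfl | hm
  · simp
  rcases Nat.eq_zero_or_pos d with rfl | hd
  · simpa using hR
  have h1 := pow_le_pow_left₀ (by positivity) (h.trans (hP.divergence_mean_le S hS θ)) 2
  rw [mul_pow 2, Real.sq_sqrt (by positivity)] at h1
  have hm' : (0 : ℝ) < m := by exact_mod_cast hm
  have hd' : (0 : ℝ) < d := by exact_mod_cast hd
  have h2 : a ^ 2 * (m * d) = (a * m) ^ 2 * (d / m) := by field_simp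
  have h3 : 4 * P.N * (P.r * P.evolutionTime) ^ 2 * (P.cov S θ).trace =
      2 ^ 2 * (P.N * ((P.r * P.evolutionTime) ^ 2 * (m / d)) * (P.cov S θ).trace) * (d / m) := by
    field_simp
    ring
  rw [h2, h3]
  exact mul_le_mul_of_nonneg_right h1 (by positivity)

/-- The variance bound for unbiased estimators. On the boundary of the search ball the derivative
of the bias vanishes by continuity. -/
theorem BoundedEst.le_of_unbiased (hP : P.BoundedEst) (hS : S.IsSpherical) {E : ℝ} (hE : 0 < E)
    (hb : ∀ θ : Param m, ‖θ‖ ≤ E → P.bias S θ = 0) {θ : Param m} (hθ : ‖θ‖ ≤ E) :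
    (m : ℝ) * d ≤ 4 * P.N * (P.r * P.evolutionTime) ^ 2 * (P.cov S θ).trace := by
  have h0 : Set.EqOn (divergence (P.bias S)) (fun _ => 0) (Metric.ball 0 E) := by
    intro η hη
    have h1 : P.bias S =ᶠ[nhds η] fun _ => 0 := by
      filter_upwards [Metric.isOpen_ball.mem_nhds hη] with ζ hζ
      exact hb ζ (by simpa using (Metric.mem_ball.1 hζ).le)
    simp [divergence, partials, h1.fderiv_eq]
  have h1 := h0.closure (continuous_divergence (hP.contDiff_bias S)) continuous_const
  rw [closure_ball _ hE.ne'] at h1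
  have h2 := h1 (x := θ) (by simpa using hθ)
  have h3 := hP.sq_mul_le_of_le_divergence S hS (θ := θ) zero_le_one (by
    rw [hP.divergence_mean, h2, one_mul, add_zero])
  simpa using h3

/-- The variance bound under a constraint on the bias: since `√6 δ < (5δ) / 2`, the divergence of the
bias exceeds `-m / 2` at some point of the ball of radius `5δ`. -/
theorem BoundedEst.exists_le_of_bias_le (hP : P.BoundedEst) (hS : S.IsSpherical) (hm : 0 < m)
    {δ : ℝ} (hδ : 0 < δ)
    (hb : ∀ θ : Param m, ‖θ‖ ≤ 5 * δ → ‖P.bias S θ‖ ≤ Real.sqrt 6 * δ) :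
    ∃ θ : Param m, ‖θ‖ ≤ 5 * δ ∧ DifferentiableAt ℝ (P.bias S) θ ∧
      (m : ℝ) / 2 < (1 + P.biasDeriv S θ).trace ∧
      (m : ℝ) * d ≤ 16 * P.N * (P.r * P.evolutionTime) ^ 2 * (P.cov S θ).trace := by
  have h6 : Real.sqrt 6 < 5 / 2 := (Real.sqrt_lt' (by norm_num)).2 (by norm_num)
  obtain ⟨θ, hθ, hdiv⟩ := exists_divergence_gt hm (hP.contDiff_bias S) (R := 5 * δ) (c := 1 / 2)
    (by positivity) hb (by nlinarith)
  have htr : (m : ℝ) / 2 < m + divergence (P.bias S) θ := by linarith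
  refine ⟨θ, hθ, (hP.contDiff_bias S).differentiable one_ne_zero θ, ?_, ?_⟩
  · rwa [trace_one_add_biasDeriv]
  · have h := hP.sq_mul_le_of_le_divergence S hS (θ := θ) (a := 1 / 2) (by norm_num) (by
      rw [hP.divergence_mean]
      linarith)
    linarith

/-! ### Successful procedures -/

/-- The mean square error is the sum of the squared bias and the variance. -/
theorem BoundedEst.sum_integral_sq_error (hP : P.BoundedEst) (θ : Param m) :
    ∫ ω, ‖P.est ω - θ‖ ^ 2 ∂P.law S θ = ‖P.bias S θ‖ ^ 2 + (P.cov S θ).trace := by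
  obtain ⟨C, hC⟩ := hP.exists_abs_le
  have hi : ∀ j, Integrable (fun ω => P.est ω j) (P.law S θ) := fun j =>
    (integrable_const C).mono' (P.measurable_est_apply j).aestronglyMeasurable
      (Filter.Eventually.of_forall fun ω => hC ω j)
  have hi2 : ∀ j (c : ℝ), Integrable (fun ω => (P.est ω j - c) ^ 2) (P.law S θ) := fun j c =>
    (integrable_const ((C + |c|) ^ 2)).mono'
      (((P.measurable_est_apply j).sub_const c).pow_const 2).aestronglyMeasurable
      (Filter.Eventually.of_forall fun ω => by
        rw [Real.norm_eq_abs, abs_pow]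
        exact pow_le_pow_left₀ (abs_nonneg _)
          ((abs_sub _ _).trans (by gcongr; exact hC ω j)) 2)
  simp only [EuclideanSpace.norm_sq_eq, Real.norm_eq_abs, sq_abs, PiLp.sub_apply]
  rw [integral_finsetSum _ fun j _ => hi2 j _, trace_cov, ← Finset.sum_add_distrib]
  refine Finset.sum_congr rfl fun j _ => ?_
  have h1 : ∀ ω, (P.est ω j - θ j) ^ 2 = (P.est ω j - P.mean S θ j) ^ 2 +
      (2 * (P.bias S θ j) * (P.est ω j - P.mean S θ j) + (P.bias S θ j) ^ 2) := by
    intro ω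
    simp only [bias, PiLp.sub_apply]
    ring
  simp only [h1]
  have hc : Integrable (fun ω => 2 * P.bias S θ j * (P.est ω j - P.mean S θ j)) (P.law S θ) :=
    ((hi j).sub (integrable_const _)).const_mul _
  have hc2 : Integrable (fun ω => 2 * P.bias S θ j * (P.est ω j - P.mean S θ j) +
      P.bias S θ j ^ 2) (P.law S θ) := hc.add (integrable_const _)
  rw [integral_add (hi2 j _) hc2, integral_add hc (integrable_const _), integral_const_mul,
    integral_sub (hi j) (integrable_const _), integral_const, integral_const,
    hP.mean_apply]
  simp
  ring

end Procedure

/-- The nearest point of the ball of radius `R`. -/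
def clip {m : ℕ} (R : ℝ) (y : Param m) : Param m := if ‖y‖ ≤ R then y else (R / ‖y‖) • y

theorem norm_clip_le {m : ℕ} {R : ℝ} (hR : 0 ≤ R) (y : Param m) : ‖clip R y‖ ≤ R := by
  unfold clip
  split_ifs with h
  · exact h
  · have hy : 0 < ‖y‖ := hR.trans_lt (not_le.1 h)
    rw [norm_smul, Real.norm_eq_abs, abs_of_nonneg (by positivity), div_mul_cancel₀ _ hy.ne']

theorem norm_clip_sub_le {m : ℕ} {R : ℝ} {θ : Param m} (hθ : ‖θ‖ ≤ R) (y : Param m) :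
    ‖clip R y - θ‖ ≤ ‖y - θ‖ := by
  unfold clip
  split_ifs with h
  · exact le_rfl
  · have hR : 0 ≤ R := (norm_nonneg θ).trans hθ
    have hy : R < ‖y‖ := not_le.1 h
    have hy0 : 0 < ‖y‖ := hR.trans_lt hy
    refine (sq_le_sq₀ (norm_nonneg _) (norm_nonneg _)).1 ?_
    rw [norm_sub_sq_real, norm_sub_sq_real, norm_smul, inner_smul_left, Real.norm_eq_abs,
      abs_of_nonneg (by positivity), div_mul_cancel₀ _ hy0.ne']
    simp only [conj_trivial]
    have h1 : inner ℝ y θ ≤ ‖y‖ * R :=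
      (real_inner_le_norm y θ).trans (mul_le_mul_of_nonneg_left hθ hy0.le)
    have h2 : 0 ≤ 1 - R / ‖y‖ := by
      rw [sub_nonneg, div_le_one hy0]
      exact hy.le
    have h3 : (1 - R / ‖y‖) * inner ℝ y θ ≤ (1 - R / ‖y‖) * (‖y‖ * R) :=
      mul_le_mul_of_nonneg_left h1 h2
    have h4 : (1 - R / ‖y‖) * (‖y‖ * R) = ‖y‖ * R - R ^ 2 := by field_simp
    nlinarith [sq_nonneg (‖y‖ - R)]

theorem measurable_clip {m : ℕ} (R : ℝ) : Measurable (clip (m := m) R) :=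
  Measurable.ite (measurableSet_le measurable_norm measurable_const) measurable_id
    ((measurable_const.div measurable_norm).smul measurable_id)

namespace Procedure

variable {d m : ℕ} {α : Type*} {Ω : Type*} [MeasurableSpace Ω] (P : Procedure d m α Ω)
  (S : Model d m)

/-- The procedure with its estimates projected to the ball of radius `R`. -/
def clipped (R : ℝ) : Procedure d m α Ω :=
  { P with est := fun ω => clip R (P.est ω)
           measurable_est := (measurable_clip R).comp P.measurable_est }

theorem clipped_stateAt (R : ℝ) (θ : Param m) (k : ℕ) :
    (P.clipped R).stateAt S θ k = P.stateAt S θ k := by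
  induction k with
  | zero => rfl
  | succ k ih => exact congrArg (fun ψ => P.drive S θ (P.time (k + 1)) (P.control k ψ)) ih

theorem clipped_law (R : ℝ) (θ : Param m) : (P.clipped R).law S θ = P.law S θ :=
  congrArg (fun ψ => P.meas.law (tensorPower P.N ψ)) (P.clipped_stateAt S R θ P.n)

theorem boundedEst_clipped {R : ℝ} (hR : 0 ≤ R) : (P.clipped R).BoundedEst :=
  ⟨R, fun _ => norm_clip_le hR _⟩

/-- An estimate outside the tolerated error is off by at most `10 δ` after clipping, and this
happens with probability at most `0.05`: the mean square error is at most
`0.95 δ² + 0.05 (10 δ)² ≤ 6 δ²`. -/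
theorem integral_sq_error_clipped_le {δ : ℝ} (hδ : 0 < δ) {θ : Param m} (hθ : ‖θ‖ ≤ 5 * δ)
    (h : P.law S θ {ω | δ < ‖P.est ω - θ‖} ≤ ENNReal.ofReal 0.05) :
    ∫ ω, ‖(P.clipped (5 * δ)).est ω - θ‖ ^ 2 ∂(P.clipped (5 * δ)).law S θ ≤ 6 * δ ^ 2 := by
  rw [clipped_law]
  set A : Set Ω := {ω | δ < ‖P.est ω - θ‖}
  have hA : MeasurableSet A :=
    measurableSet_lt measurable_const (P.measurable_est.sub_const θ).norm
  have hA' : (P.law S θ).real A ≤ 0.05 := ENNReal.toReal_le_of_le_ofReal (by norm_num) h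
  have hi : Integrable (A.indicator fun _ => 99 * δ ^ 2) (P.law S θ) :=
    (integrable_const _).indicator hA
  have h1 : ∫ ω, ‖(P.clipped (5 * δ)).est ω - θ‖ ^ 2 ∂P.law S θ ≤
      ∫ ω, δ ^ 2 + A.indicator (fun _ => 99 * δ ^ 2) ω ∂P.law S θ := by
    refine integral_mono_of_nonneg (Filter.Eventually.of_forall fun ω => sq_nonneg _)
      ((integrable_const _).add hi) (Filter.Eventually.of_forall fun ω => ?_)
    change ‖clip (5 * δ) (P.est ω) - θ‖ ^ 2 ≤ δ ^ 2 + A.indicator (fun _ => 99 * δ ^ 2) ω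
    by_cases hω : ω ∈ A
    · rw [Set.indicator_of_mem hω]
      have h2 := norm_clip_le (by positivity : (0 : ℝ) ≤ 5 * δ) (P.est ω)
      have h3 := norm_sub_le (clip (5 * δ) (P.est ω)) θ
      nlinarith [norm_nonneg (clip (5 * δ) (P.est ω) - θ)]
    · rw [Set.indicator_of_notMem hω, add_zero]
      exact pow_le_pow_left₀ (norm_nonneg _)
        ((norm_clip_sub_le hθ _).trans (not_lt.1 hω)) 2
  refine h1.trans ?_
  rw [integral_add (integrable_const _) hi, integral_const, integral_indicator_const _ hA]
  simp only [probReal_univ, smul_eq_mul, one_mul]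
  nlinarith [sq_nonneg δ]

/-- After clipping, both the squared bias and the variance are at most `6 δ²` on the ball of radius
`5δ`, so the variance bound under a constraint on the bias applies. -/
theorem Successful.le_totalTime {P : Procedure d m α Ω} {S : Model d m} (hS : S.IsSpherical)
    {δ E : ℝ} (hδ : 0 < δ) (hE : 5 * δ ≤ E) (h : P.Successful S δ E) :
    Real.sqrt ((m : ℝ) * d) / (4 * Real.sqrt 6 * δ) ≤ P.totalTime := by
  have hτ := P.evolutionTime_nonneg
  have hT : 0 ≤ P.totalTime := by
    unfold totalTime
    positivity
  rcases Nat.eq_zero_or_pos m with rfl | hm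
  · simpa using hT
  have hR : 0 ≤ 5 * δ := by positivity
  have hB := P.boundedEst_clipped hR
  have hmse : ∀ θ : Param m, ‖θ‖ ≤ 5 * δ →
      ‖(P.clipped (5 * δ)).bias S θ‖ ^ 2 + ((P.clipped (5 * δ)).cov S θ).trace ≤ 6 * δ ^ 2 := by
    intro θ hθ
    rw [← hB.sum_integral_sq_error]
    exact P.integral_sq_error_clipped_le S hδ hθ (h θ (hθ.trans hE))
  obtain ⟨θ, hθ, -, -, hle⟩ := hB.exists_le_of_bias_le S hS hm hδ fun θ hθ => by
    refine (sq_le_sq₀ (norm_nonneg _) (by positivity)).1 ?_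
    rw [mul_pow, Real.sq_sqrt (by norm_num)]
    linarith [hmse θ hθ, (P.clipped (5 * δ)).trace_cov_nonneg S θ]
  have hV : ((P.clipped (5 * δ)).cov S θ).trace ≤ 6 * δ ^ 2 := by
    linarith [hmse θ hθ, sq_nonneg ‖(P.clipped (5 * δ)).bias S θ‖]
  change (m : ℝ) * d ≤ 16 * P.N * (P.r * P.evolutionTime) ^ 2 * _ at hle
  have hN : (P.N : ℝ) ≤ (P.N : ℝ) ^ 2 := by exact_mod_cast Nat.le_self_pow two_ne_zero P.N
  rw [div_le_iff₀ (by positivity)]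
  refine Real.sqrt_le_iff.2 ⟨by positivity, ?_⟩
  calc (m : ℝ) * d
      ≤ 16 * P.N * (P.r * P.evolutionTime) ^ 2 * ((P.clipped (5 * δ)).cov S θ).trace := hle
    _ ≤ 16 * (P.N : ℝ) ^ 2 * (P.r * P.evolutionTime) ^ 2 * (6 * δ ^ 2) := by
        refine mul_le_mul ?_ hV ((P.clipped (5 * δ)).trace_cov_nonneg S θ) (by positivity)
        gcongr
    _ = (P.totalTime * (4 * Real.sqrt 6 * δ)) ^ 2 := by
        have h6 : Real.sqrt 6 ^ 2 = 6 := Real.sq_sqrt (by norm_num)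
        rw [totalTime]
        linear_combination -(16 * (P.N : ℝ) ^ 2 * (P.r * P.evolutionTime) ^ 2 * δ ^ 2) * h6

end Procedure

end HamEst

end

theorem mainTheorem3 {d m : ℕ} (S : HamEst.Model d m) (hS : S.IsSpherical)
    {α : Type*} {Ω : Type*} [MeasurableSpace Ω] (P : HamEst.Procedure d m α Ω)
    (δ E : ℝ) (hδ : 0 < δ) (hE : 5 * δ ≤ E) :
    -- the lower bound on the total time of a successful, possibly biased, procedure
    (P.Successful S δ E →
      Real.sqrt ((m : ℝ) * d) / (4 * Real.sqrt 6 * δ) ≤ P.totalTime) ∧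
    -- the variance bound for unbiased estimators
    (P.BoundedEst → (∀ θ : HamEst.Param m, ‖θ‖ ≤ E → P.bias S θ = 0) →
      ∀ θ : HamEst.Param m, ‖θ‖ ≤ E →
        (m : ℝ) * d ≤ 4 * P.N * (P.r * P.evolutionTime) ^ 2 * (P.cov S θ).trace) ∧
    -- under a constraint on the bias, the bound changes by a factor of at most four
    (0 < m → P.BoundedEst →
      (∀ θ : HamEst.Param m, ‖θ‖ ≤ E → ‖P.bias S θ‖ ≤ Real.sqrt 6 * δ) →
      ∃ θ : HamEst.Param m, ‖θ‖ ≤ 5 * δ ∧ DifferentiableAt ℝ (P.bias S) θ ∧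
        (m : ℝ) / 2 < (1 + P.biasDeriv S θ).trace ∧
        (m : ℝ) * d ≤ 16 * P.N * (P.r * P.evolutionTime) ^ 2 * (P.cov S θ).trace) :=
  ⟨fun h => h.le_totalTime hS hδ hE,
    fun hP hb _ hθ => hP.le_of_unbiased S hS (by linarith) hb hθ,
    fun hm hP hb => hP.exists_le_of_bias_le S hS hm hδ fun θ hθ => hb θ (hθ.trans hE)⟩
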